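/- A standard dyadic (s.d.) interval is an interval $[\frac{k}{2^m},\frac{k+1}{2^m}]$ with integers $m\ge 0$, $0\le k\le 2^m-1$. An s.d. $n$-partition $\mathcal I$ consists of breakpoints $0=a_0<a_1<\dots<a_n=1$ such that every $[a_{i},a_{i+1}]$ is an s.d. interval; it corresponds to the binary tree $F_{\mathcal I}$ with $n$ leaves whose edges are the s.d. intervals $[a_i,a_j]$, a non-leaf edge splitting into its left and right halves (the uppermost edge is $[0,1]$). A pair $(\mathcal I,\mathcal J)$ of s.d. $n$-partitions with breakpoints $(a_i)$, $(b_i)$ represents the homeomorphism $g$ of $[0,1]$ with $g(a_i)=b_i$ that is linear on each $[a_i,a_{i+1}]$. These $g$ are the elements of the Thompson group $F$ (orientation-preserving piecewise linear homeomorphisms of $[0,1]$ with slopes powers of $2$ and dyadic rational breakpoints). Every $g\in F$ is represented by a unique reduced pair, i.e. a pair representing $g$ that does not refine any other pair representing $g$; its number $n$ of subintervals is the leaf number of $g$. Signs. Draw $F_{\mathcal I}$ in the strip above $[0,1]$ with leaves on the bottom, and give signs to the regions of its complement other than the rightmost one: the leftmost region is $+$, and at every trivalent vertex the region below the vertex has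 the sign opposite to the region to its left. This gives a sequence $\sigma_{\mathcal I}$ of $n$ signs. The oriented Thompson group $\vec F$ consists of the $g\in F$ that are represented by some pair $(\mathcal I,\mathcal J)$ with $\sigma_{\mathcal I}=\sigma_{\mathcal J}$. Links. The tangle $T_{\mathcal I}$ is obtained from $F_{\mathcal I}$, drawn so that the lower end of the edge $A$ lies above the midpoint of $A$, by replacing each trivalent vertex $B$ by a crossing: the over-strand joins the two edges leaving $B$ downwards, and the under-strand joins the edge entering $B$ from above to a vertical line from $B$ down to the midpoint of $B$ (a breakpoint of $\mathcal I$). Let $(\mathcal I,\mathcal J)$ be the reduced pair representing $g$. The lower endpoints of $T_{\mathcal I}$ are the midpoints of the subintervals of $\mathcal I$ and the breakpoints of $\mathcal I$ in $(0,1)$. Join them in order, without crossings, to the corresponding points of $\mathcal J$, continue with the upside-down mirror image of $T_{\mathcal J}$ (over-strands staying over), and join the top and bottom ends by a closing arc. The result is the link $L_g\subset\mathbb R^3$. (For $g\in\vec F$ the signs orient $L_g$.) Theorem. If $g\in\vec F$ has leaf number $n$, then the number $|L_g|$ of components of $L_g$ is finite and satisfies $$|L_g|\equiv n \pmod 2 .$$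 -/

import Mathlib

open Set

/-! ### Standard dyadic intervals and partitions -/

/-- `[l, r]` is a standard dyadic interval `[k / 2 ^ m, (k + 1) / 2 ^ m]` with `0 ≤ k ≤ 2 ^ m - 1`. -/
def IsStdDyadic (l r : ℝ) : Prop :=
  ∃ m k : ℕ, k < 2 ^ m ∧ l = (k : ℝ) / 2 ^ m ∧ r = ((k : ℝ) + 1) / 2 ^ m

/-- A standard dyadic `n`-partition `0 = a₀ < a₁ < ... < aₙ = 1` of `[0, 1]`. -/
structure SDPartition (n : ℕ) where
  /-- The breakpoints. -/
  a : Fin (n + 1) → ℝ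
  strictMono : StrictMono a
  zero : a 0 = 0
  last : a (Fin.last n) = 1
  dyadic : ∀ i : Fin n, IsStdDyadic (a i.castSucc) (a i.succ)

/-! ### The Thompson group -/

/-- The Thompson group `F`: the orientation-preserving piecewise linear homeomorphisms of `[0, 1]`
whose slopes are powers of `2` and whose breakpoints are dyadic rational numbers. -/
def thompsonGroup : Set (unitInterval ≃ₜ unitInterval) :=
  {g | StrictMono g ∧
    ∃ (m : ℕ) (t : Fin (m + 1) → ℝ), StrictMono t ∧ t 0 = 0 ∧ t (Fin.last m) = 1 ∧
      (∀ i, ∃ p q : ℕ, t i = (p : ℝ) / 2 ^ q) ∧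
      ∀ i : Fin m, ∃ (e : ℤ) (c : ℝ), ∀ x : unitInterval,
        t i.castSucc ≤ x → (x : ℝ) ≤ t i.succ → (g x : ℝ) = (2 : ℝ) ^ e * x + c}

/-- The pair `(I, J)` of standard dyadic `n`-partitions represents `g`: the map `g` sends the
`i`-th breakpoint of `I` to the `i`-th breakpoint of `J` and is linear in between. -/
def Represents {n : ℕ} (I J : SDPartition n) (g : unitInterval ≃ₜ unitInterval) : Prop :=
  ∀ (i : Fin n) (x : unitInterval), I.a i.castSucc ≤ x → (x : ℝ) ≤ I.a i.succ →
    (g x : ℝ) = J.a i.castSucc +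
      (J.a i.succ - J.a i.castSucc) / (I.a i.succ - I.a i.castSucc) * ((x : ℝ) - I.a i.castSucc)

/-- `(I, J)` is a reduced pair representing `g`: it represents `g`, and it is not a refinement of
any other pair `(K, L)` representing `g`. -/
def IsReducedPair {n : ℕ} (I J : SDPartition n) (g : unitInterval ≃ₜ unitInterval) : Prop :=
  Represents I J g ∧
    ∀ (k : ℕ) (K L : SDPartition k), Represents K L g →
      range K.a ⊆ range I.a → range L.a ⊆ range J.a →
        range K.a = range I.a ∧ range L.a = range J.a

/-- `σ` is the sequence of signs of the regions of the complement of the binary tree of `I`, without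
the rightmost region; `σ i` is the sign of the region above the breakpoint `a i`. The leftmost
region has sign `+`. For a trivalent vertex of the tree, i.e. a standard dyadic interval
`[a i, a j]` whose midpoint `a k` is a breakpoint, the region on the left of the vertex is the one
above `a i`, the region below it is the one above `a k`, and the signs of the two are opposite. -/
def IsRegionSigning {n : ℕ} (I : SDPartition n) (σ : Fin n → ℤˣ) : Prop :=
  (∀ i : Fin n, I.a i.castSucc = 0 → σ i = 1) ∧
    ∀ (i k : Fin n) (j : Fin (n + 1)), IsStdDyadic (I.a i.castSucc) (I.a j) →
      I.a k.castSucc = (I.a i.castSucc + I.a j) / 2 → σ k = -σ i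

/-- The oriented Thompson group: the elements of `F` that are represented by some pair of
partitions whose trees induce the same sequence of signs. -/
def orientedThompsonGroup : Set (unitInterval ≃ₜ unitInterval) :=
  {g | g ∈ thompsonGroup ∧ ∃ (n : ℕ) (I J : SDPartition n), Represents I J g ∧
    ∃ σ : Fin n → ℤˣ, IsRegionSigning I σ ∧ IsRegionSigning J σ}

/-! ### The Thompson link

Points of `ℝ³` are written `(x, y, z)`; diagrams are drawn in the `(x, y)`-plane, and the larger
`z` is over. -/

namespace SDPartition

variable {n : ℕ}

/-- The standard dyadic intervals `[l, r]` whose endpoints are breakpoints of `I`. They label the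
edges of the binary tree of `I`. -/
def intervals (I : SDPartition n) : Set (ℝ × ℝ) :=
  {A | A.1 ∈ range I.a ∧ A.2 ∈ range I.a ∧ IsStdDyadic A.1 A.2}

/-- The members of `I.intervals` that are not subintervals of `I`. They label the edges whose lower
end is a trivalent vertex of the binary tree of `I`. -/
def vertices (I : SDPartition n) : Set (ℝ × ℝ) :=
  {A | A ∈ I.intervals ∧ ∀ i : Fin n, A ≠ (I.a i.castSucc, I.a i.succ)}

end SDPartition

/-- The midpoint of `[l, r]`. -/
noncomputable def intervalMid (A : ℝ × ℝ) : ℝ := (A.1 + A.2) / 2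

/-- The length of `[l, r]`. -/
def intervalLen (A : ℝ × ℝ) : ℝ := A.2 - A.1

/-- The tangle `T_I`, in the strip `0 ≤ y ≤ 2`. The lower end of the tree edge labelled `A` is at
`(intervalMid A, intervalLen A)`; the uppermost edge starts at `(1/2, 2)`.
At a trivalent vertex `B` there is a crossing. Its over-strand (at height `z = 1`) joins the two
edges that leave `B` downwards, labelled by the two halves of `B`. Its under-strand (at height
`z = 0`) joins the edge coming from above to the vertical line from the vertex down to the
breakpoint `intervalMid B`. Also each lowermost edge `A` is continued vertically down to
`intervalMid A`. -/
def tangle {n : ℕ} (I : SDPartition n) : Set (ℝ × ℝ × ℝ) :=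
  segment ℝ (1 / 2, 2, 0) (1 / 2, 1, 0) ∪
  (⋃ B ∈ I.vertices,
    segment ℝ (intervalMid B, intervalLen B, 1) (intervalMid B - intervalLen B / 4, intervalLen B / 2, 0) ∪
    segment ℝ (intervalMid B, intervalLen B, 1) (intervalMid B + intervalLen B / 4, intervalLen B / 2, 0)) ∪
  ⋃ A ∈ I.intervals, segment ℝ (intervalMid A, intervalLen A, 0) (intervalMid A, 0, 0)

/-- The trivial tangle in the strip `-1 ≤ y ≤ 0`, joining by straight lines, in order, the
breakpoints in `(0, 1)` and the midpoints of the subintervals of `I` to those of `J`. -/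
def shiftTangle {n : ℕ} (I J : SDPartition n) : Set (ℝ × ℝ × ℝ) :=
  (⋃ i : Fin n, segment ℝ
    (intervalMid (I.a i.castSucc, I.a i.succ), 0, 0) (intervalMid (J.a i.castSucc, J.a i.succ), -1, 0)) ∪
  ⋃ (i : Fin (n + 1)) (_ : i ≠ 0 ∧ i ≠ Fin.last n), segment ℝ (I.a i, 0, 0) (J.a i, -1, 0)

/-- The vertical mirror (upside down, over-strands staying over), taking the strip `0 ≤ y ≤ 2` to
the strip `-3 ≤ y ≤ -1`. -/
def vmirror (p : ℝ × ℝ × ℝ) : ℝ × ℝ × ℝ := (p.1, -1 - p.2.1, p.2.2)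

/-- The arc that closes up a tangle from `(1/2, 2)` to `(1/2, -3)`, on its left. -/
def closingArc : Set (ℝ × ℝ × ℝ) :=
  segment ℝ (1 / 2, 2, 0) (-1, 2, 0) ∪ segment ℝ (-1, 2, 0) (-1, -3, 0) ∪
    segment ℝ (-1, -3, 0) (1 / 2, -3, 0)

/-- The polygonal link `L_(I, J)` in `ℝ³`: `T_I`, followed by the trivial tangle from `I` to `J` and
the vertical mirror of `T_J`, closed up. -/
def pairLink {n : ℕ} (I J : SDPartition n) : Set (ℝ × ℝ × ℝ) :=
  tangle I ∪ shiftTangle I J ∪ vmirror '' tangle J ∪ closingArc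

/-! ### The reduced pair, the leaf number and the link of an element -/

theorem SDPartition.ext_of_range {n : ℕ} {I J : SDPartition n} (h : range I.a = range J.a) :
    I = J := by
  have : I.a = J.a := (StrictMono.range_inj I.strictMono J.strictMono).1 h
  cases I; cases J; cases this; rfl

theorem SDPartition.card_eq {n : ℕ} (I : SDPartition n) : (range I.a).ncard = n + 1 := by
  rw [← Set.image_univ, Set.ncard_image_of_injective _ I.strictMono.injective]
  simp [Set.ncard_univ]

/-- A map that is represented by some pair is represented by a reduced pair. -/
theorem exists_isReducedPair {g : unitInterval ≃ₜ unitInterval}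
    (h : ∃ (n : ℕ) (I J : SDPartition n), Represents I J g) :
    ∃ (n : ℕ) (I J : SDPartition n), IsReducedPair I J g := by
  classical
  obtain ⟨I, J, hIJ⟩ := Nat.find_spec h
  refine ⟨Nat.find h, I, J, hIJ, fun k K L hKL hK hL => ?_⟩
  have h1 : Nat.find h ≤ k := Nat.find_min' h ⟨K, L, hKL⟩
  constructor
  · refine Set.eq_of_subset_of_ncard_le hK ?_ (Set.finite_range _)
    rw [K.card_eq, I.card_eq]; omega
  · refine Set.eq_of_subset_of_ncard_le hL ?_ (Set.finite_range _)
    rw [L.card_eq, J.card_eq]; omega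

theorem SDPartition.mem_Icc {n : ℕ} (I : SDPartition n) (i : Fin (n + 1)) : I.a i ∈ Icc (0 : ℝ) 1 :=
  ⟨I.zero ▸ I.strictMono.monotone (Fin.zero_le i), I.last ▸ I.strictMono.monotone (Fin.le_last i)⟩

theorem Represents.left {n : ℕ} {I J : SDPartition n} {g : unitInterval ≃ₜ unitInterval}
    (h : Represents I J g) (i : Fin n) :
    (g ⟨I.a i.castSucc, I.mem_Icc _⟩ : ℝ) = J.a i.castSucc := by
  have := h i ⟨I.a i.castSucc, I.mem_Icc _⟩ le_rfl
    (I.strictMono.monotone (Fin.castSucc_lt_succ (i := i)).le)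
  simpa using this

theorem Represents.right {n : ℕ} {I J : SDPartition n} {g : unitInterval ≃ₜ unitInterval}
    (h : Represents I J g) (i : Fin n) :
    (g ⟨I.a i.succ, I.mem_Icc _⟩ : ℝ) = J.a i.succ := by
  have := h i ⟨I.a i.succ, I.mem_Icc _⟩
    (I.strictMono.monotone (Fin.castSucc_lt_succ (i := i)).le) le_rfl
  have h2 : I.a i.succ - I.a i.castSucc ≠ 0 :=
    sub_ne_zero.2 (I.strictMono (Fin.castSucc_lt_succ (i := i))).ne'
  rw [this]
  field_simp
  ring

theorem SDPartition.pos {n : ℕ} (I : SDPartition n) : 0 < n := by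
  rcases Nat.eq_zero_or_pos n with rfl | h
  · have h1 := I.zero
    have h2 := I.last
    simp only [Fin.last_zero] at h2
    rw [h1] at h2
    norm_num at h2
  · exact h

theorem Represents.apply {n : ℕ} {I J : SDPartition n} {g : unitInterval ≃ₜ unitInterval}
    (h : Represents I J g) (i : Fin (n + 1)) :
    (g ⟨I.a i, I.mem_Icc _⟩ : ℝ) = J.a i := by
  refine Fin.lastCases ?_ (fun i => h.left i) i
  obtain ⟨m, rfl⟩ := Nat.exists_eq_succ_of_ne_zero I.pos.ne'
  exact h.right (Fin.last m)

/-- Standard dyadic intervals are nested or have disjoint interiors. -/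
theorem IsStdDyadic.nested {l r l' r' : ℝ} (h : IsStdDyadic l r) (h' : IsStdDyadic l' r')
    (h1 : l < r') (h2 : l' < r) : (l ≤ l' ∧ r' ≤ r) ∨ (l' ≤ l ∧ r ≤ r') := by
  have key : ∀ m k m' k' : ℕ, m ≤ m' → (k : ℝ) / 2 ^ m < ((k' : ℝ) + 1) / 2 ^ m' →
      (k' : ℝ) / 2 ^ m' < ((k : ℝ) + 1) / 2 ^ m →
      (k : ℝ) / 2 ^ m ≤ (k' : ℝ) / 2 ^ m' ∧ ((k' : ℝ) + 1) / 2 ^ m' ≤ ((k : ℝ) + 1) / 2 ^ m := by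
    intro m k m' k' hm ha hb
    obtain ⟨d, rfl⟩ := Nat.exists_eq_add_of_le hm
    have e : ∀ x : ℝ, x / 2 ^ m = (x * 2 ^ d) / 2 ^ (m + d) := by
      intro x; rw [pow_add]; field_simp
    rw [e] at ha ⊢
    rw [e] at hb ⊢
    have hp : (0 : ℝ) < 2 ^ (m + d) := by positivity
    rw [div_lt_div_iff_of_pos_right hp] at ha hb
    rw [div_le_div_iff_of_pos_right hp, div_le_div_iff_of_pos_right hp]
    have ha' : k * 2 ^ d < k' + 1 := by exact_mod_cast ha
    have hb' : k' < (k + 1) * 2 ^ d := by exact_mod_cast hb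
    constructor
    · exact_mod_cast Nat.lt_succ_iff.1 ha'
    · exact_mod_cast hb'
  obtain ⟨m, k, -, rfl, rfl⟩ := h
  obtain ⟨m', k', -, rfl, rfl⟩ := h'
  rcases le_total m m' with hm | hm
  · exact Or.inl (key m k m' k' hm h1 h2)
  · exact Or.inr (key m' k' m k hm h2 h1)

theorem SDPartition.exists_left {n : ℕ} (I : SDPartition n) {x : ℝ} (hx : x ∈ range I.a)
    (h1 : x < 1) : ∃ i : Fin n, I.a i.castSucc = x := by
  obtain ⟨j, rfl⟩ := hx
  have hj : j ≠ Fin.last n := fun h => by rw [h, I.last] at h1; exact lt_irrefl _ h1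
  exact ⟨j.castPred hj, by simp⟩

/-- No breakpoint lies strictly inside a subinterval. -/
theorem SDPartition.gap {n : ℕ} (I : SDPartition n) (i : Fin n) {x : ℝ} (hx : x ∈ range I.a)
    (h1 : I.a i.castSucc < x) : I.a i.succ ≤ x := by
  obtain ⟨j, rfl⟩ := hx
  have := I.strictMono.lt_iff_lt.1 h1
  exact I.strictMono.monotone (Fin.le_def.2 (Nat.succ_le_of_lt (Fin.lt_def.1 this)))

/-- Every point of `[0, 1)` lies in a subinterval. -/
theorem SDPartition.cover {n : ℕ} (I : SDPartition n) {x : ℝ} (h0 : 0 ≤ x) (h1 : x < 1) :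
    ∃ i : Fin n, I.a i.castSucc ≤ x ∧ x < I.a i.succ := by
  by_contra! hc
  have : ∀ j : Fin (n + 1), I.a j ≤ x := by
    intro j
    induction j using Fin.induction with
    | zero => rw [I.zero]; exact h0
    | succ i ih => exact hc i ih
  have := this (Fin.last n)
  rw [I.last] at this
  linarith

/-- If a subinterval of `I'` starts at the left end of a subinterval of `I` and is not longer than
it, then the right end of the latter is a breakpoint of `I'`. -/
theorem SDPartition.right_mem {n n' : ℕ} (I : SDPartition n) (I' : SDPartition n') (i : Fin n)
    (i' : Fin n') (hl : I.a i.castSucc = I'.a i'.castSucc) (hr : I'.a i'.succ ≤ I.a i.succ) :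
    I.a i.succ ∈ range I'.a := by
  rcases (I.mem_Icc i.succ).2.lt_or_eq with h1 | h1
  swap
  · exact ⟨Fin.last n', by rw [I'.last, h1]⟩
  obtain ⟨c, hc1, hc2⟩ := I'.cover (I.mem_Icc i.succ).1 h1
  rcases hc1.eq_or_lt with h | h
  · exact ⟨_, h⟩
  exfalso
  have hi := I.strictMono (Fin.castSucc_lt_succ (i := i))
  rcases (I.dyadic i).nested (I'.dyadic c) (hi.trans hc2) h with h3 | h3
  · linarith [h3.2]
  · have hi' := I'.strictMono (Fin.castSucc_lt_succ (i := i'))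
    have : I'.a c.castSucc < I'.a i'.succ := by linarith [h3.1]
    have := I'.gap c (x := I'.a i'.succ) ⟨_, rfl⟩ this
    linarith

/-- Two pairs representing the same map refine a common pair representing it. -/
theorem Represents.exists_common {n n' : ℕ} {I J : SDPartition n} {I' J' : SDPartition n'}
    {g : unitInterval ≃ₜ unitInterval} (h : Represents I J g) (h' : Represents I' J' g) :
    ∃ (k : ℕ) (K L : SDPartition k), Represents K L g ∧
      range K.a ⊆ range I.a ∧ range L.a ⊆ range J.a ∧
      range K.a ⊆ range I'.a ∧ range L.a ⊆ range J'.a := by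
  classical
  set s : Finset ℝ := Finset.univ.image I.a ∩ Finset.univ.image I'.a with hs
  have hmem : ∀ x, x ∈ s ↔ x ∈ range I.a ∧ x ∈ range I'.a := by intro x; simp [hs]
  have h0 : (0 : ℝ) ∈ s := (hmem 0).2 ⟨⟨0, I.zero⟩, ⟨0, I'.zero⟩⟩
  have h1 : (1 : ℝ) ∈ s := (hmem 1).2 ⟨⟨_, I.last⟩, ⟨_, I'.last⟩⟩
  have hIcc : ∀ x ∈ s, x ∈ Icc (0 : ℝ) 1 := by
    intro x hx
    obtain ⟨j, rfl⟩ := ((hmem x).1 hx).1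
    exact I.mem_Icc j
  obtain ⟨k, hk⟩ := Nat.exists_eq_succ_of_ne_zero (Finset.card_pos.2 ⟨0, h0⟩).ne'
  set a : Fin (k + 1) → ℝ := fun i => s.orderEmbOfFin hk i with ha
  have hamono : StrictMono a := (s.orderEmbOfFin hk).strictMono
  have har : range a = s := Finset.range_orderEmbOfFin s hk
  have has : ∀ i, a i ∈ s := fun i => Finset.orderEmbOfFin_mem s hk i
  have haz : a 0 = 0 := by
    obtain ⟨j, hj⟩ : (0 : ℝ) ∈ range a := by rw [har]; exact h0
    exact le_antisymm (hj ▸ hamono.monotone (Fin.zero_le j)) (hIcc _ (has 0)).1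
  have hal : a (Fin.last k) = 1 := by
    obtain ⟨j, hj⟩ : (1 : ℝ) ∈ range a := by rw [har]; exact h1
    exact le_antisymm (hIcc _ (has _)).2 (hj ▸ hamono.monotone (Fin.le_last j))
  have hagap : ∀ i : Fin k, ∀ x ∈ s, a i.castSucc < x → a i.succ ≤ x := by
    intro i x hx hlt
    obtain ⟨j, rfl⟩ : x ∈ range a := by rw [har]; exact hx
    exact hamono.monotone (Fin.le_def.2 (Nat.succ_le_of_lt (Fin.lt_def.1 (hamono.lt_iff_lt.1 hlt))))
  -- every subinterval of the common coarsening is a subinterval of one of the two partitions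
  have hleaf : ∀ i : Fin k,
      (∃ j : Fin n, I.a j.castSucc = a i.castSucc ∧ I.a j.succ = a i.succ) ∨
      (∃ j : Fin n', I'.a j.castSucc = a i.castSucc ∧ I'.a j.succ = a i.succ) := by
    intro i
    have hlt : a i.castSucc < 1 :=
      (hamono (Fin.castSucc_lt_succ (i := i))).trans_le (hIcc _ (has _)).2
    obtain ⟨hm, hm'⟩ := (hmem _).1 (has i.castSucc)
    obtain ⟨hn, hn'⟩ := (hmem _).1 (has i.succ)
    obtain ⟨j, hj⟩ := I.exists_left hm hlt
    obtain ⟨j', hj'⟩ := I'.exists_left hm' hlt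
    have hi := hamono (Fin.castSucc_lt_succ (i := i))
    rcases le_total (I'.a j'.succ) (I.a j.succ) with hle | hle
    · left
      have hr := I.right_mem I' j j' (hj.trans hj'.symm) hle
      refine ⟨j, hj, le_antisymm (I.gap j hn (hj ▸ hi)) ?_⟩
      exact hagap i _ ((hmem _).2 ⟨⟨_, rfl⟩, hr⟩)
        (hj ▸ I.strictMono (Fin.castSucc_lt_succ (i := j)))
    · right
      have hr := I'.right_mem I j' j (hj'.trans hj.symm) hle
      refine ⟨j', hj', le_antisymm (I'.gap j' hn' (hj' ▸ hi)) ?_⟩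
      exact hagap i _ ((hmem _).2 ⟨hr, ⟨_, rfl⟩⟩)
        (hj' ▸ I'.strictMono (Fin.castSucc_lt_succ (i := j')))
  set b : Fin (k + 1) → ℝ := fun i => (g ⟨a i, hIcc _ (has i)⟩ : ℝ) with hb
  have hbJ : ∀ (i : Fin (k + 1)) (j : Fin (n + 1)), I.a j = a i → b i = J.a j := by
    intro i j hj
    rw [← h.apply j]
    simp only [hb]
    congr 2
    exact Subtype.ext hj.symm
  have hbJ' : ∀ (i : Fin (k + 1)) (j : Fin (n' + 1)), I'.a j = a i → b i = J'.a j := by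
    intro i j hj
    rw [← h'.apply j]
    simp only [hb]
    congr 2
    exact Subtype.ext hj.symm
  have hbmono : StrictMono b := by
    intro i i' hii
    obtain ⟨j, hj⟩ := ((hmem _).1 (has i)).1
    obtain ⟨j', hj'⟩ := ((hmem _).1 (has i')).1
    rw [hbJ i j hj, hbJ i' j' hj']
    apply J.strictMono
    rw [← I.strictMono.lt_iff_lt, hj, hj']
    exact hamono hii
  refine ⟨k, ⟨a, hamono, haz, hal, ?_⟩, ⟨b, hbmono, ?_, ?_, ?_⟩, ?_, ?_, ?_, ?_, ?_⟩
  · intro i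
    rcases hleaf i with ⟨j, hj, hj2⟩ | ⟨j, hj, hj2⟩
    · rw [← hj, ← hj2]; exact I.dyadic j
    · rw [← hj, ← hj2]; exact I'.dyadic j
  · rw [hbJ 0 0 (by rw [I.zero, haz]), J.zero]
  · rw [hbJ (Fin.last k) (Fin.last n) (by rw [I.last, hal]), J.last]
  · intro i
    rcases hleaf i with ⟨j, hj, hj2⟩ | ⟨j, hj, hj2⟩
    · rw [hbJ _ _ hj, hbJ _ _ hj2]; exact J.dyadic j
    · rw [hbJ' _ _ hj, hbJ' _ _ hj2]; exact J'.dyadic j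
  · intro i x hx1 hx2
    dsimp only at hx1 hx2 ⊢
    rcases hleaf i with ⟨j, hj, hj2⟩ | ⟨j, hj, hj2⟩
    · rw [hbJ _ _ hj, hbJ _ _ hj2]
      rw [← hj, ← hj2]
      exact h j x (hj.trans_le hx1) (hx2.trans_eq hj2.symm)
    · rw [hbJ' _ _ hj, hbJ' _ _ hj2]
      rw [← hj, ← hj2]
      exact h' j x (hj.trans_le hx1) (hx2.trans_eq hj2.symm)
  · rintro _ ⟨i, rfl⟩; exact ((hmem _).1 (has i)).1
  · rintro _ ⟨i, rfl⟩
    obtain ⟨j, hj⟩ := ((hmem _).1 (has i)).1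
    exact ⟨j, (hbJ i j hj).symm⟩
  · rintro _ ⟨i, rfl⟩; exact ((hmem _).1 (has i)).2
  · rintro _ ⟨i, rfl⟩
    obtain ⟨j, hj⟩ := ((hmem _).1 (has i)).2
    exact ⟨j, (hbJ' i j hj).symm⟩

/-- The reduced pair representing a given map is unique. -/
theorem IsReducedPair.unique {n n' : ℕ} {I J : SDPartition n} {I' J' : SDPartition n'}
    {g : unitInterval ≃ₜ unitInterval} (h : IsReducedPair I J g) (h' : IsReducedPair I' J' g) :
    (⟨n, I, J⟩ : Σ n, SDPartition n × SDPartition n) = ⟨n', I', J'⟩ := by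
  obtain ⟨k, K, L, hKL, h1, h2, h3, h4⟩ := h.1.exists_common h'.1
  obtain ⟨e1, e2⟩ := h.2 k K L hKL h1 h2
  obtain ⟨e3, e4⟩ := h'.2 k K L hKL h3 h4
  have hn : n = n' := by
    have := I.card_eq
    rw [← e1, e3, I'.card_eq] at this
    omega
  subst hn
  rw [I.ext_of_range (e1.symm.trans e3), J.ext_of_range (e2.symm.trans e4)]

theorem existsUnique_reducedPair (g : orientedThompsonGroup) :
    ∃! p : Σ n, SDPartition n × SDPartition n, IsReducedPair p.2.1 p.2.2 (g : _ ≃ₜ _) := by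
  obtain ⟨-, n, I, J, hIJ, -⟩ := g.2
  obtain ⟨n, I, J, h⟩ := exists_isReducedPair ⟨n, I, J, hIJ⟩
  exact ⟨⟨n, I, J⟩, h, fun p hp => IsReducedPair.unique hp h⟩

/-- The unique reduced pair of partitions representing `g`, with its number of subintervals. -/
noncomputable def reducedPair (g : orientedThompsonGroup) :
    Σ n, SDPartition n × SDPartition n :=
  (existsUnique_reducedPair g).choose

/-- The leaf number of `g`. -/
noncomputable def leafNumber (g : orientedThompsonGroup) : ℕ := (reducedPair g).1

/-- The link `L_g`. -/
noncomputable def thompsonLink (g : orientedThompsonGroup) : Set (ℝ × ℝ × ℝ) :=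
  pairLink (reducedPair g).2.1 (reducedPair g).2.2

/-! The link is cut into arcs: `n` strands of the upper tangle, `n` strands of the mirrored lower
tangle, and `2 * n` wires between them, one of which is the closing arc. Components then become
cycles of two perfect matchings of the `2 * n` wires, and the parity is a statement about signs of
permutations.

Strand `k ≠ 0` starts from the over-strand at the vertex with midpoint `a k`. Its two legs run
straight down, passing under any later crossing, to the midpoints of the two halves of that vertex.
Strand `0` runs from the top to `1 / 2`. Midpoints determine standard dyadic intervals, so the ends
of the strands correspond bijectively to the endpoints of the tangle. This gives the permutation
`matching`.

The points `(k, false)` and `(k, true)` carry the opposite signs `σ k` and `-σ k`. The sign rule at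
vertices says exactly that `matching` preserves signs (`pointSign_matching`), so every strand joins
a positive point to a negative one. Forgetting the Boolean, the upper strands thus define a
permutation `p` of `Fin n`, from the index of the positive end to that of the negative end; the
lower strands define `q` likewise. Each tree is connected in the sense that its strands connect all
of `Fin n` (`eqvGen_baseRel`), so `p` and `q` are `n`-cycles and have equal sign. The components of
the link are the orbits of `q⁻¹ * p`, which is even. Since the sign of a permutation of `n` letters
with `c` orbits is `(-1) ^ (n + c)`, it follows that `c ≡ n` modulo `2` (`card_quot_matchRel`).

The geometric half (`strand_inter`, `wire_inter`, `strand_inter_wire`) shows that the arcs meet only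
at their prescribed ends. Finally, a common signing of some representing pair restricts to the
reduced pair (`IsReducedPair.exists_signing`). -/

/-! ### Connected components of a finite union of closed connected sets -/

/-- The connected components of a finite union of closed connected sets are the classes of the
equivalence relation on the sets generated by intersecting each other. -/
theorem nonempty_connectedComponents_iUnion_equiv {α ι : Type*} [TopologicalSpace α] [Finite ι]
    (S : ι → Set α) (hc : ∀ i, IsClosed (S i)) (hp : ∀ i, IsConnected (S i)) :
    Nonempty (ConnectedComponents (⋃ i, S i : Set α) ≃
      Quot (fun i j => (S i ∩ S j).Nonempty)) := by
  set X : Set α := ⋃ i, S i with hX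
  set r : ι → ι → Prop := fun i j => (S i ∩ S j).Nonempty with hr
  have hsub : ∀ i, S i ⊆ X := fun i => subset_iUnion S i
  have hex : ∀ x : X, ∃ i, (x : α) ∈ S i := fun x => mem_iUnion.1 x.2
  choose ind hind using hex
  have hne : ∀ i, ∃ x : X, (x : α) ∈ S i := fun i => by
    obtain ⟨x, hx⟩ := (hp i).nonempty
    exact ⟨⟨x, hsub i hx⟩, hx⟩
  choose pt hpt using hne
  -- With the discrete topology on the classes, a continuous map into them is constant on
  -- components. The map `f` below does not depend on the chosen piece, because two pieces through a
  -- common point are related; hence preimages are finite unions of closed pieces.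
  let _ : TopologicalSpace (Quot r) := ⊥
  have : DiscreteTopology (Quot r) := ⟨rfl⟩
  set f : X → Quot r := fun x => Quot.mk r (ind x) with hf
  have hfi : ∀ (x : X) i, (x : α) ∈ S i → f x = Quot.mk r i := fun x i hx =>
    Quot.sound ⟨x, hind x, hx⟩
  have hcont : Continuous f := by
    rw [continuous_iff_isClosed]
    intro T _
    have : f ⁻¹' T = ⋃ i : {i // Quot.mk r i ∈ T}, ((↑) : X → α) ⁻¹' S i := by
      ext x
      simp only [mem_preimage, mem_iUnion, Subtype.exists, exists_prop]
      constructor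
      · intro hx
        exact ⟨ind x, hx, hind x⟩
      · rintro ⟨i, hi, hx⟩
        rw [hfi x i hx]
        exact hi
    rw [this]
    exact isClosed_iUnion_of_finite fun i => (hc i).preimage continuous_subtype_val
  have hsame : ∀ i (x y : X), (x : α) ∈ S i → (y : α) ∈ S i →
      (x : ConnectedComponents X) = y := by
    intro i x y hx hy
    rw [ConnectedComponents.coe_eq_coe']
    have hpre : IsPreconnected (((↑) : X → α) ⁻¹' S i) := by
      rw [← Topology.IsInducing.subtypeVal.isPreconnected_image, Subtype.image_preimage_coe,
        inter_eq_right.2 (hsub i)]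
      exact (hp i).isPreconnected
    exact hpre.subset_connectedComponent (x := y) hy hx
  refine ⟨⟨hcont.connectedComponentsLift,
    Quot.lift (fun i => ((pt i : X) : ConnectedComponents X)) ?_, ?_, ?_⟩⟩
  · rintro i j ⟨x, hi, hj⟩
    exact (hsame i _ ⟨x, hsub i hi⟩ (hpt i) hi).trans (hsame j _ _ hj (hpt j))
  · intro c
    obtain ⟨x, rfl⟩ := ConnectedComponents.surjective_coe c
    rw [hcont.connectedComponentsLift_apply_coe]
    exact hsame (ind x) _ _ (hpt _) (hind x)
  · intro q
    induction q using Quot.ind with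
    | mk i =>
      change hcont.connectedComponentsLift ((pt i : X) : ConnectedComponents X) = _
      rw [hcont.connectedComponentsLift_apply_coe]
      exact hfi _ _ (hpt i)

/-! ### Permutations: orbits and signs -/

/-- The number of orbits of a permutation is the number of its cycles plus the number of its fixed
points. -/
theorem Equiv.Perm.card_quotient_sameCycle {α : Type*} [Fintype α] [DecidableEq α]
    (f : Equiv.Perm α) :
    Nat.card (Quotient (SameCycle.setoid f)) =
      Multiset.card f.cycleType + (Fintype.card α - f.support.card) := by
  have hsupp : ∀ c : f.cycleFactorsFinset, ∃ x, x ∈ (c : Equiv.Perm α).support := fun c =>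
    (mem_cycleFactorsFinset_iff.1 c.2).1.nonempty_support
  choose rep hrep using hsupp
  have hcyc : ∀ c : f.cycleFactorsFinset, (c : Equiv.Perm α) = f.cycleOf (rep c) := fun c =>
    cycle_is_cycleOf (hrep c) c.2
  have hmem : ∀ c : f.cycleFactorsFinset, rep c ∈ f.support := fun c =>
    mem_cycleFactorsFinset_support_le c.2 (hrep c)
  set F : f.cycleFactorsFinset ⊕ (f.supportᶜ : Finset α) → Quotient (SameCycle.setoid f) :=
    Sum.elim (fun c => Quotient.mk _ (rep c)) (fun x => Quotient.mk _ (x : α)) with hF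
  have hfix : ∀ x : (f.supportᶜ : Finset α), f x = x := fun x =>
    notMem_support.1 (Finset.mem_compl.1 x.2)
  have hbij : Function.Bijective F := by
    constructor
    · rintro (c | x) (d | y) h
      · have h : SameCycle f (rep c) (rep d) := Quotient.exact h
        have : (c : Equiv.Perm α) = d := by
          rw [hcyc c, hcyc d, h.cycleOf_eq]
        rw [Subtype.ext this]
      · have h : SameCycle f (rep c) y := Quotient.exact h
        have := h.symm.eq_of_left (hfix y)
        exact absurd (this ▸ hmem c) (Finset.mem_compl.1 y.2)
      · have h : SameCycle f x (rep d) := Quotient.exact h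
        have := h.eq_of_left (hfix x)
        exact absurd (this ▸ hmem d) (Finset.mem_compl.1 x.2)
      · have h : SameCycle f x y := Quotient.exact h
        rw [Subtype.ext (h.eq_of_left (hfix x))]
    · intro q
      induction q using Quotient.ind with
      | _ x =>
        by_cases hx : x ∈ f.support
        · have hc : f.cycleOf x ∈ f.cycleFactorsFinset := cycleOf_mem_cycleFactorsFinset_iff.2 hx
          refine ⟨Sum.inl ⟨_, hc⟩, Quotient.sound ?_⟩
          change SameCycle f (rep ⟨_, hc⟩) x
          exact (sameCycle_iff_cycleOf_eq_of_mem_support (hmem _) hx).2 (hcyc ⟨_, hc⟩).symm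
        · exact ⟨Sum.inr ⟨x, by simpa using hx⟩, rfl⟩
  rw [← Nat.card_eq_of_bijective F hbij, Nat.card_eq_fintype_card, Fintype.card_sum,
    Fintype.card_coe, Fintype.card_coe, Finset.card_compl, cycleType_def]
  simp

/-- The cycle type gives the exponent as size of the support plus number of nontrivial cycles. Each
of the `d` fixed points adds one to the cardinality and one to the number of orbits, which leaves
the parity unchanged. -/
theorem Equiv.Perm.sign_eq_neg_one_pow_card_quotient {α : Type*} [Fintype α] [DecidableEq α]
    (f : Equiv.Perm α) :
    sign f = (-1) ^ (Fintype.card α + Nat.card (Quotient (SameCycle.setoid f))) := by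
  have hle : f.support.card ≤ Fintype.card α := Finset.card_le_univ _
  obtain ⟨d, hd⟩ := Nat.exists_eq_add_of_le hle
  rw [f.sign_of_cycleType, f.card_quotient_sameCycle, f.sum_cycleType, hd,
    show f.support.card + d + (Multiset.card f.cycleType + (f.support.card + d - f.support.card)) =
      f.support.card + Multiset.card f.cycleType + 2 * d by omega, pow_add _ _ (2 * d), pow_mul]
  simp

/-! ### Pairs of matchings of oriented points -/

section Matching

variable {n : ℕ}

/-- Two perfect matchings of `Fin n × Bool`, whose strands join the points `E (k, false)` and
`E (k, true)`, respectively `F (k, false)` and `F (k, true)`. -/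
def MatchRel (E F : Equiv.Perm (Fin n × Bool)) (x y : Fin n × Bool) : Prop :=
  ∃ k, (x = E (k, false) ∧ y = E (k, true)) ∨ (x = F (k, false) ∧ y = F (k, true))

/-- The relation on `Fin n` that the strands of a matching of `Fin n × Bool` induce. -/
def BaseRel (E : Equiv.Perm (Fin n × Bool)) (i j : Fin n) : Prop :=
  ∃ k, i = (E (k, false)).1 ∧ j = (E (k, true)).1

/-- The point over `k` with orientation `s`. -/
def orientedPoint (o : Fin n × Bool → Bool) (s : Bool) (k : Fin n) : Fin n × Bool :=
  (k, xor (o (k, false)) s)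

variable {o : Fin n × Bool → Bool}

theorem orientation_orientedPoint (ho : ∀ k b, o (k, !b) = !o (k, b))
    (s : Bool) (k : Fin n) : o (orientedPoint o s k) = s := by
  have h1 : o (k, true) = !o (k, false) := ho k false
  unfold orientedPoint
  cases h : o (k, false) <;> cases s <;> simp [h, h1]

theorem eq_orientedPoint (ho : ∀ k b, o (k, !b) = !o (k, b))
    (q : Fin n × Bool) : q = orientedPoint o (o q) q.1 := by
  obtain ⟨k, b⟩ := q
  have h1 : o (k, true) = !o (k, false) := ho k false
  unfold orientedPoint
  cases b <;> cases h : o (k, false) <;> simp [h, h1]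

/-- The permutation that an orientation-preserving permutation of the points induces on the points
with orientation `s`. -/
theorem exists_perm_orientedPoint (ho : ∀ k b, o (k, !b) = !o (k, b))
    {E : Equiv.Perm (Fin n × Bool)} (hE : ∀ q, o (E q) = o q)
    (s : Bool) : ∃ u : Equiv.Perm (Fin n),
      ∀ k, E (orientedPoint o s k) = orientedPoint o s (u k) := by
  have h1 : ∀ k, E (orientedPoint o s k) = orientedPoint o s (E (orientedPoint o s k)).1 := by
    intro k
    have := eq_orientedPoint ho (E (orientedPoint o s k))
    rwa [hE, orientation_orientedPoint ho] at this
  have hinj : Function.Injective fun k => (E (orientedPoint o s k)).1 := by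
    intro k l h
    have h : (E (orientedPoint o s k)).1 = (E (orientedPoint o s l)).1 := h
    have : E (orientedPoint o s k) = E (orientedPoint o s l) := by rw [h1 k, h1 l, h]
    exact congrArg Prod.fst (E.injective this)
  exact ⟨Equiv.ofBijective _ (Finite.injective_iff_bijective.1 hinj), h1⟩

/-- Translates between the two labellings of the points over `k`: by side, as in `MatchRel` and
`BaseRel`, and by orientation, as in the induced permutations. -/
theorem points_eq_or (o : Fin n × Bool → Bool) (k : Fin n) :
    ((k, false) = orientedPoint o true k ∧ (k, true) = orientedPoint o false k) ∨
      ((k, false) = orientedPoint o false k ∧ (k, true) = orientedPoint o true k) := by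
  unfold orientedPoint
  cases o (k, false) <;> simp

/-- If the strands of an oriented matching connect `Fin n`, then the permutation of `Fin n` that
follows the strands is an `n`-cycle, so that its sign is `(-1) ^ (n + 1)`. -/
theorem sign_of_baseRel_connected
    (hn : 0 < n) {E : Equiv.Perm (Fin n × Bool)}
    {u d : Equiv.Perm (Fin n)} (hu : ∀ k, E (orientedPoint o true k) = orientedPoint o true (u k))
    (hd : ∀ k, E (orientedPoint o false k) = orientedPoint o false (d k))
    (hconn : ∀ i j, Relation.EqvGen (BaseRel E) i j) :
    Equiv.Perm.sign (d * u⁻¹) = (-1) ^ (n + 1) := by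
  -- The permutation `d * u⁻¹` moves the index of the positive end of a strand to that of its
  -- negative end, so the two ends of a strand lie in one cycle.
  have hstep : ∀ k, (d * u⁻¹).SameCycle (u k) (d k) := fun k => ⟨1, by simp⟩
  have hall : ∀ i j, (d * u⁻¹).SameCycle i j := by
    intro i j
    induction hconn i j with
    | rel i j h =>
      obtain ⟨k, rfl, rfl⟩ := h
      rcases points_eq_or o k with ⟨h1, h2⟩ | ⟨h1, h2⟩
      · rw [h1, h2, hu, hd]; exact hstep k
      · rw [h1, h2, hu, hd]; exact (hstep k).symm
    | refl i => exact Equiv.Perm.SameCycle.refl _ i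
    | symm i j _ ih => exact ih.symm
    | trans i j k _ _ ih1 ih2 => exact ih1.trans ih2
  have hcard : Nat.card (Quotient (Equiv.Perm.SameCycle.setoid (d * u⁻¹))) = 1 := by
    rw [Nat.card_eq_one_iff_unique]
    refine ⟨⟨fun x y => ?_⟩, ⟨Quotient.mk _ ⟨0, hn⟩⟩⟩
    induction x using Quotient.ind
    induction y using Quotient.ind
    exact Quotient.sound (hall _ _)
  rw [Equiv.Perm.sign_eq_neg_one_pow_card_quotient, hcard, Fintype.card_fin]

/-- Two oriented matchings, both of which connect `Fin n`, form a number of cycles that has the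
parity of `n`. -/
theorem card_quot_matchRel (ho : ∀ k b, o (k, !b) = !o (k, b))
    (hn : 0 < n) {E F : Equiv.Perm (Fin n × Bool)}
    (hE : ∀ q, o (E q) = o q) (hF : ∀ q, o (F q) = o q)
    (cE : ∀ i j, Relation.EqvGen (BaseRel E) i j) (cF : ∀ i j, Relation.EqvGen (BaseRel F) i j) :
    Nat.card (Quot (MatchRel E F)) ≡ n [MOD 2] := by
  obtain ⟨u, hu⟩ := exists_perm_orientedPoint ho hE true
  obtain ⟨d, hd⟩ := exists_perm_orientedPoint ho hE false
  obtain ⟨v, hv⟩ := exists_perm_orientedPoint ho hF true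
  obtain ⟨e, he⟩ := exists_perm_orientedPoint ho hF false
  set p := d * u⁻¹ with hp
  set q := e * v⁻¹ with hq
  -- One round trip: from the positive point over `i` along a strand of `E` to the negative point
  -- over `p i`, then back along a strand of `F` to the positive point over `q⁻¹ (p i)`.
  set τ := q⁻¹ * p with hτ
  have hrel : ∀ k, Quot.mk (MatchRel E F) (orientedPoint o true (u k)) =
      Quot.mk (MatchRel E F) (orientedPoint o false (d k)) := by
    intro k
    rw [← hu, ← hd]
    rcases points_eq_or o k with ⟨h1, h2⟩ | ⟨h1, h2⟩
    · rw [← h1, ← h2]; exact Quot.sound ⟨k, Or.inl ⟨rfl, rfl⟩⟩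
    · rw [← h1, ← h2]; exact (Quot.sound ⟨k, Or.inl ⟨rfl, rfl⟩⟩).symm
  have hrel' : ∀ k, Quot.mk (MatchRel E F) (orientedPoint o true (v k)) =
      Quot.mk (MatchRel E F) (orientedPoint o false (e k)) := by
    intro k
    rw [← hv, ← he]
    rcases points_eq_or o k with ⟨h1, h2⟩ | ⟨h1, h2⟩
    · rw [← h1, ← h2]; exact Quot.sound ⟨k, Or.inr ⟨rfl, rfl⟩⟩
    · rw [← h1, ← h2]; exact (Quot.sound ⟨k, Or.inr ⟨rfl, rfl⟩⟩).symm
  have hP : ∀ i, Quot.mk (MatchRel E F) (orientedPoint o true i) =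
      Quot.mk (MatchRel E F) (orientedPoint o false (p i)) := by
    intro i; simpa [hp] using hrel (u⁻¹ i)
  have hQ : ∀ i, Quot.mk (MatchRel E F) (orientedPoint o true i) =
      Quot.mk (MatchRel E F) (orientedPoint o false (q i)) := by
    intro i; simpa [hq] using hrel' (v⁻¹ i)
  have hT : ∀ i, Quot.mk (MatchRel E F) (orientedPoint o true (τ i)) =
      Quot.mk (MatchRel E F) (orientedPoint o true i) := by
    intro i
    rw [hQ, hP]
    simp [hτ]
  have hT' : ∀ (m : ℕ) i, Quot.mk (MatchRel E F) (orientedPoint o true ((τ ^ m) i)) =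
      Quot.mk (MatchRel E F) (orientedPoint o true i) := by
    intro m
    induction m with
    | zero => intro i; simp
    | succ m ih => intro i; rw [pow_succ', Equiv.Perm.mul_apply, hT, ih]
  -- A negative point is assigned the orbit of the positive point at the other end of its
  -- `E`-strand.
  let toQuot : Fin n × Bool → Quotient (Equiv.Perm.SameCycle.setoid τ) := fun x =>
    if o x then Quotient.mk _ x.1 else Quotient.mk _ (p⁻¹ x.1)
  have htrue : ∀ i, toQuot (orientedPoint o true i) = Quotient.mk _ i := by
    intro i
    simp only [toQuot, orientation_orientedPoint ho, if_true]
    rfl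
  have hfalse : ∀ i, toQuot (orientedPoint o false i) = Quotient.mk _ (p⁻¹ i) := by
    intro i
    simp only [toQuot, orientation_orientedPoint ho]
    rfl
  have hEk : ∀ k, toQuot (E (orientedPoint o true k)) = toQuot (E (orientedPoint o false k)) := by
    intro k
    rw [hu, hd, htrue, hfalse]
    simp [hp]
  have hFk : ∀ k, toQuot (F (orientedPoint o true k)) = toQuot (F (orientedPoint o false k)) := by
    intro k
    rw [hv, he, htrue, hfalse]
    refine (Quotient.sound ?_)
    change τ.SameCycle _ _
    -- Here `τ⁻¹ = p⁻¹ * q`, and `q` takes `v k` to `e k`.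
    refine ⟨-1, ?_⟩
    simp [hτ, hq]
  have hequiv : Quot (MatchRel E F) ≃ Quotient (Equiv.Perm.SameCycle.setoid τ) := by
    refine ⟨Quot.lift toQuot ?_,
      Quotient.lift (fun i => Quot.mk (MatchRel E F) (orientedPoint o true i)) ?_, ?_, ?_⟩
    · rintro _ _ ⟨k, ⟨rfl, rfl⟩ | ⟨rfl, rfl⟩⟩ <;>
        rcases points_eq_or o k with ⟨h1, h2⟩ | ⟨h1, h2⟩ <;> rw [h1, h2]
      · exact hEk k
      · exact (hEk k).symm
      · exact hFk k
      · exact (hFk k).symm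
    · intro i j hij
      obtain ⟨m, rfl⟩ := Equiv.Perm.SameCycle.exists_nat_pow_eq hij
      exact (hT' m i).symm
    · intro x
      induction x using Quot.ind with
      | mk x =>
        rw [eq_orientedPoint ho x]
        cases o x
        · change Quotient.lift _ _ (toQuot _) = _
          rw [hfalse]
          change Quot.mk _ (orientedPoint o true (p⁻¹ x.1)) = _
          rw [hP]
          simp
        · change Quotient.lift _ _ (toQuot _) = _
          rw [htrue]
          rfl
    · intro x
      induction x using Quotient.ind with
      | _ i => exact htrue i
  have hsign : Equiv.Perm.sign τ = 1 := by
    rw [hτ, map_mul, Equiv.Perm.sign_inv, sign_of_baseRel_connected hn hu hd cE,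
      sign_of_baseRel_connected hn hv he cF]
    exact Int.units_mul_self _
  rw [Equiv.Perm.sign_eq_neg_one_pow_card_quotient, Fintype.card_fin] at hsign
  rw [Nat.card_congr hequiv]
  have heven : Even (n + Nat.card (Quotient (Equiv.Perm.SameCycle.setoid τ))) := by
    by_contra hodd
    rw [Nat.not_even_iff_odd] at hodd
    rw [hodd.neg_one_pow] at hsign
    exact absurd hsign (by decide)
  rw [Nat.even_iff] at heven
  unfold Nat.ModEq
  omega

end Matching

/-! ### Standard dyadic intervals -/

theorem IsStdDyadic.nonneg {l r : ℝ} (h : IsStdDyadic l r) : 0 ≤ l := by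
  obtain ⟨m, k, -, rfl, -⟩ := h
  positivity

theorem IsStdDyadic.le_one {l r : ℝ} (h : IsStdDyadic l r) : r ≤ 1 := by
  obtain ⟨m, k, hk, -, rfl⟩ := h
  rw [div_le_one (by positivity)]
  exact_mod_cast hk

theorem IsStdDyadic.lt {l r : ℝ} (h : IsStdDyadic l r) : l < r := by
  obtain ⟨m, k, hk, rfl, rfl⟩ := h
  gcongr
  linarith

theorem IsStdDyadic.left_half {l r : ℝ} (h : IsStdDyadic l r) : IsStdDyadic l ((l + r) / 2) := by
  obtain ⟨m, k, hk, rfl, rfl⟩ := h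
  refine ⟨m + 1, 2 * k, by rw [pow_succ]; omega, ?_, ?_⟩ <;> push_cast <;> field_simp <;> ring

theorem IsStdDyadic.right_half {l r : ℝ} (h : IsStdDyadic l r) : IsStdDyadic ((l + r) / 2) r := by
  obtain ⟨m, k, hk, rfl, rfl⟩ := h
  refine ⟨m + 1, 2 * k + 1, by rw [pow_succ]; omega, ?_, ?_⟩ <;> push_cast <;> field_simp <;> ring

theorem isStdDyadic_zero_one : IsStdDyadic 0 1 := ⟨0, 0, by norm_num, by norm_num, by norm_num⟩

/-- Were one interval strictly inside the other with the same midpoint, it would straddle an end of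
the left half of the larger one, contradicting nestedness. -/
theorem IsStdDyadic.mid_inj {l r l' r' : ℝ} (h : IsStdDyadic l r) (h' : IsStdDyadic l' r')
    (hm : (l + r) / 2 = (l' + r') / 2) : l = l' ∧ r = r' := by
  have key : ∀ {l r l' r' : ℝ}, IsStdDyadic l r → IsStdDyadic l' r' →
      (l + r) / 2 = (l' + r') / 2 → ¬ l < l' := by
    intro l r l' r' h h' hm hl
    have h1 := h.lt
    have h2 := h'.lt
    rcases h.left_half.nested h' (by linarith) (by linarith) with h3 | h3 <;> linarith [h3.1, h3.2]
  have h1 := key h h' hm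
  have h2 := key h' h hm.symm
  have : l = l' := le_antisymm (not_lt.1 h2) (not_lt.1 h1)
  exact ⟨this, by linarith⟩

/-- Two standard dyadic intervals of the same length whose interiors meet are equal. -/
theorem IsStdDyadic.eq_of_length {l r l' r' : ℝ} (h : IsStdDyadic l r) (h' : IsStdDyadic l' r')
    (hlen : r - l = r' - l') (h1 : l < r') (h2 : l' < r) : l = l' ∧ r = r' := by
  rcases h.nested h' h1 h2 with h3 | h3 <;> constructor <;> linarith [h3.1, h3.2]

/-- Every dyadic rational number in `(0, 1)` is the midpoint of a standard dyadic interval. -/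
theorem exists_isStdDyadic_mid (q p : ℕ) (hp : 0 < p) (hpq : p < 2 ^ q) :
    ∃ l r : ℝ, IsStdDyadic l r ∧ (l + r) / 2 = (p : ℝ) / 2 ^ q := by
  induction q generalizing p with
  | zero => simp at hpq; omega
  | succ q ih =>
    rw [pow_succ] at hpq
    rcases Nat.even_or_odd' p with ⟨k, rfl | rfl⟩
    · obtain ⟨l, r, h, hm⟩ := ih k (by omega) (by omega)
      refine ⟨l, r, h, hm.trans ?_⟩
      rw [pow_succ]; push_cast; field_simp
    · refine ⟨(k : ℝ) / 2 ^ q, ((k : ℝ) + 1) / 2 ^ q, ⟨q, k, by omega, rfl, rfl⟩, ?_⟩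
      rw [pow_succ]; push_cast; field_simp; ring

/-! ### The nodes of the tree of a partition -/

/-- The left half (`false`) or right half (`true`) of an interval. -/
noncomputable def halfInterval (A : ℝ × ℝ) (b : Bool) : ℝ × ℝ :=
  if b then (intervalMid A, A.2) else (A.1, intervalMid A)

theorem intervalMid_halfInterval_false (A : ℝ × ℝ) :
    intervalMid (halfInterval A false) = intervalMid A - intervalLen A / 4 := by
  simp only [halfInterval, intervalMid, intervalLen, Bool.false_eq_true, if_false]; ring

theorem intervalMid_halfInterval_true (A : ℝ × ℝ) :
    intervalMid (halfInterval A true) = intervalMid A + intervalLen A / 4 := by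
  simp only [halfInterval, intervalMid, intervalLen, if_true]; ring

theorem intervalLen_halfInterval (A : ℝ × ℝ) (b : Bool) :
    intervalLen (halfInterval A b) = intervalLen A / 2 := by
  cases b <;> simp [halfInterval, intervalMid, intervalLen] <;> ring

theorem IsStdDyadic.halfInterval {A : ℝ × ℝ} (h : IsStdDyadic A.1 A.2) (b : Bool) :
    IsStdDyadic (halfInterval A b).1 (halfInterval A b).2 := by
  cases b
  · exact h.left_half
  · exact h.right_half

/-- A half of a standard dyadic interval determines the interval and the side. -/
theorem IsStdDyadic.halfInterval_mid_inj {A B : ℝ × ℝ} (hA : IsStdDyadic A.1 A.2)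
    (hB : IsStdDyadic B.1 B.2) {b c : Bool}
    (h : intervalMid (_root_.halfInterval A b) = intervalMid (_root_.halfInterval B c)) :
    A = B ∧ b = c := by
  obtain ⟨h1, h2⟩ := (hA.halfInterval b).mid_inj (hB.halfInterval c) h
  have h3 := hA.lt
  have h4 := hB.lt
  -- Equal midpoints force the halves themselves to coincide, so `A` and `B` have the same length
  -- and overlap.
  have hAB : A = B := by
    rw [Prod.ext_iff]
    cases b <;> cases c <;> simp only [_root_.halfInterval, intervalMid, if_true, if_false,
      Bool.false_eq_true] at h1 h2 <;>
      exact hA.eq_of_length hB (by linarith) (by linarith) (by linarith)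
  refine ⟨hAB, ?_⟩
  subst hAB
  cases b <;> cases c <;> simp only [_root_.halfInterval, intervalMid, if_true, if_false,
    Bool.false_eq_true] at h1 h2 ⊢ <;> linarith

namespace SDPartition

variable {n : ℕ} (I : SDPartition n)

theorem castSucc_lt_succ (i : Fin n) : I.a i.castSucc < I.a i.succ :=
  I.strictMono Fin.castSucc_lt_succ

theorem zero_mem : (0 : ℝ) ∈ range I.a := ⟨0, I.zero⟩

theorem one_mem : (1 : ℝ) ∈ range I.a := ⟨_, I.last⟩

theorem root_mem : ((0, 1) : ℝ × ℝ) ∈ I.intervals :=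
  ⟨I.zero_mem, I.one_mem, isStdDyadic_zero_one⟩

/-- A standard dyadic interval with a breakpoint in its interior is a node. -/
theorem mem_intervals_of_breakpoint {l r c : ℝ} (h : IsStdDyadic l r) (hc : c ∈ range I.a)
    (h1 : l < c) (h2 : c < r) : (l, r) ∈ I.intervals := by
  have hl0 := h.nonneg
  have hr1 := h.le_one
  refine ⟨?_, ?_, h⟩
  · obtain ⟨i, hi1, hi2⟩ := I.cover hl0 (by linarith)
    rcases hi1.eq_or_lt with h3 | h3
    · exact ⟨_, h3⟩
    exfalso
    -- A subinterval with `l` in its interior would contain all of `[l, r]`, and with it the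
    -- breakpoint `c`.
    rcases h.nested (I.dyadic i) hi2 (by linarith) with h4 | h4
    · linarith [h4.1]
    · have := I.gap i hc (by linarith)
      linarith [h4.2]
  · rcases hr1.eq_or_lt with h3 | h3
    · exact ⟨_, I.last.trans h3.symm⟩
    obtain ⟨i, hi1, hi2⟩ := I.cover (x := r) (by linarith) h3
    rcases hi1.eq_or_lt with h3 | h3
    · exact ⟨_, h3⟩
    exfalso
    rcases h.nested (I.dyadic i) (by linarith) h3 with h4 | h4
    · linarith [h4.2]
    · have := I.gap i hc (by linarith [h4.1])
      linarith

/-- The midpoint of a vertex is a breakpoint. -/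
theorem mid_mem {A : ℝ × ℝ} (hA : A ∈ I.vertices) : intervalMid A ∈ range I.a := by
  obtain ⟨⟨h1, h2, h⟩, hleaf⟩ := hA
  have hlt := h.lt
  have hl0 := h.nonneg
  have hr1 := h.le_one
  obtain ⟨i, hi⟩ := I.exists_left h1 (by linarith)
  have hi2 := I.gap i h2 (by linarith)
  have hi1 := I.castSucc_lt_succ i
  have hi3 : I.a i.succ < A.2 := lt_of_le_of_ne hi2 fun h3 => hleaf i (by rw [hi, h3])
  -- A subinterval with the midpoint in its interior would contain both halves of `A`, hence the
  -- breakpoint `I.a i.succ`, which is interior to `A`.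
  obtain ⟨j, hj1, hj2⟩ := I.cover (x := intervalMid A) (by unfold intervalMid; linarith)
    (by unfold intervalMid; linarith)
  rcases hj1.eq_or_lt with h3 | h3
  · exact ⟨_, h3⟩
  exfalso
  have hg := I.gap j (x := I.a i.succ) ⟨_, rfl⟩
  have hml : intervalMid A = (A.1 + A.2) / 2 := rfl
  have hb : I.a j.castSucc ≤ A.1 := by
    rcases h.left_half.nested (I.dyadic j) (by linarith) (by linarith) with h4 | h4 <;>
      linarith [h4.1, h4.2]
  have hc : A.2 ≤ I.a j.succ := by
    rcases h.right_half.nested (I.dyadic j) (by linarith) (by linarith) with h4 | h4 <;>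
      linarith [h4.1, h4.2]
  linarith [hg (by linarith)]

theorem exists_leaf_or_mem_vertices {A : ℝ × ℝ} (hA : A ∈ I.intervals) :
    (∃ i : Fin n, A = (I.a i.castSucc, I.a i.succ)) ∨ A ∈ I.vertices := by
  by_cases h : ∃ i : Fin n, A = (I.a i.castSucc, I.a i.succ)
  · exact Or.inl h
  · exact Or.inr ⟨hA, fun i hi => h ⟨i, hi⟩⟩

theorem halfInterval_mem {A : ℝ × ℝ} (hA : A ∈ I.vertices) (b : Bool) :
    halfInterval A b ∈ I.intervals := by
  have hm := I.mid_mem hA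
  refine ⟨?_, ?_, hA.1.2.2.halfInterval b⟩ <;> cases b <;>
    simp only [halfInterval, Bool.false_eq_true, if_true, if_false]
  exacts [hA.1.1, hm, hm, hA.1.2.1]

theorem castSucc_pos {k : Fin n} (hk : k.val ≠ 0) : 0 < I.a k.castSucc := by
  rw [← I.zero]
  apply I.strictMono
  rw [Fin.lt_def]
  exact Nat.pos_of_ne_zero hk

theorem castSucc_eq_zero {k : Fin n} (hk : k.val = 0) : I.a k.castSucc = 0 := by
  rw [← I.zero]
  congr 1
  exact Fin.ext hk

theorem castSucc_lt_one (k : Fin n) : I.a k.castSucc < 1 :=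
  (I.castSucc_lt_succ k).trans_le (I.mem_Icc _).2

/-- Every breakpoint in `(0, 1)` is the midpoint of a vertex. -/
theorem exists_vertex {k : Fin n} (hk : k.val ≠ 0) :
    ∃ A ∈ I.vertices, intervalMid A = I.a k.castSucc := by
  have h0 := I.castSucc_pos hk
  have h1 := I.castSucc_lt_one k
  obtain ⟨m, p, hp, hl, -⟩ := I.dyadic k
  have hp0 : 0 < p := by
    rcases Nat.eq_zero_or_pos p with rfl | h
    · simp [hl] at h0
    · exact h
  obtain ⟨l, r, h, hm⟩ := exists_isStdDyadic_mid m p hp0 hp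
  rw [← hl] at hm
  have hlt := h.lt
  refine ⟨(l, r), ⟨I.mem_intervals_of_breakpoint h ⟨k.castSucc, rfl⟩ (by linarith) (by linarith),
    fun i hi => ?_⟩, hm⟩
  rw [Prod.mk.injEq] at hi
  have := I.gap i (x := I.a k.castSucc) ⟨_, rfl⟩ (by linarith)
  linarith

/-- The vertex with midpoint the `k`-th breakpoint, for `k ≠ 0`. -/
noncomputable def vertex (k : Fin n) : ℝ × ℝ :=
  Classical.epsilon fun A => A ∈ I.vertices ∧ intervalMid A = I.a k.castSucc

theorem vertex_spec {k : Fin n} (hk : k.val ≠ 0) :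
    I.vertex k ∈ I.vertices ∧ intervalMid (I.vertex k) = I.a k.castSucc :=
  Classical.epsilon_spec (I.exists_vertex hk)

theorem vertex_isStdDyadic {k : Fin n} (hk : k.val ≠ 0) :
    IsStdDyadic (I.vertex k).1 (I.vertex k).2 := (I.vertex_spec hk).1.1.2.2

theorem eq_vertex {A : ℝ × ℝ} (hA : A ∈ I.vertices) {k : Fin n}
    (h : intervalMid A = I.a k.castSucc) : k.val ≠ 0 ∧ A = I.vertex k := by
  have hk : k.val ≠ 0 := by
    intro hk
    rw [I.castSucc_eq_zero hk] at h
    have h1 := hA.1.2.2.lt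
    have h2 := hA.1.2.2.nonneg
    unfold intervalMid at h
    linarith
  have := hA.1.2.2.mid_inj (I.vertex_isStdDyadic hk) (h.trans (I.vertex_spec hk).2.symm)
  exact ⟨hk, Prod.ext this.1 this.2⟩

theorem exists_eq_vertex {A : ℝ × ℝ} (hA : A ∈ I.vertices) :
    ∃ k : Fin n, k.val ≠ 0 ∧ A = I.vertex k := by
  have h1 := hA.1.2.2.lt
  have h2 := hA.1.2.2.le_one
  obtain ⟨k, hk⟩ := I.exists_left (I.mid_mem hA) (by unfold intervalMid; linarith)
  exact ⟨k, I.eq_vertex hA hk.symm⟩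

/-- The horizontal position of the `k`-th breakpoint `(k, false)` or of the midpoint of the `k`-th
subinterval `(k, true)`. -/
noncomputable def pointX (q : Fin n × Bool) : ℝ :=
  if q.2 then intervalMid (I.a q.1.castSucc, I.a q.1.succ) else I.a q.1.castSucc

theorem pointX_false (k : Fin n) : I.pointX (k, false) = I.a k.castSucc := rfl

theorem pointX_true (k : Fin n) :
    I.pointX (k, true) = intervalMid (I.a k.castSucc, I.a k.succ) := rfl

theorem le_pointX (q : Fin n × Bool) : I.a q.1.castSucc ≤ I.pointX q := by
  have h := I.castSucc_lt_succ q.1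
  obtain ⟨k, _ | _⟩ := q
  · exact le_rfl
  · rw [pointX_true]
    unfold intervalMid
    linarith

theorem pointX_lt_succ (q : Fin n × Bool) : I.pointX q < I.a q.1.succ := by
  have h := I.castSucc_lt_succ q.1
  obtain ⟨k, _ | _⟩ := q
  · exact h
  · rw [pointX_true]
    unfold intervalMid
    linarith

/-- Breakpoints and midpoints alternate, so the lexicographic order is the order on the line for
every partition. This is why the wires from `I` to `J` do not cross. -/
theorem pointX_strictMono {q r : Fin n × Bool} (h : toLex q < toLex r) : I.pointX q < I.pointX r := by
  rcases Prod.Lex.toLex_lt_toLex.1 h with h1 | ⟨h1, h2⟩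
  · refine (I.pointX_lt_succ q).trans_le (le_trans ?_ (I.le_pointX r))
    exact I.strictMono.monotone (Fin.le_def.2 h1)
  · obtain ⟨k, b⟩ := q
    obtain ⟨l, c⟩ := r
    simp only at h1 h2
    subst h1
    obtain ⟨rfl, rfl⟩ := Bool.lt_iff.1 h2
    have h := I.castSucc_lt_succ k
    rw [pointX_false, pointX_true]
    unfold intervalMid
    linarith

theorem pointX_injective : Function.Injective I.pointX := by
  intro q r h
  by_contra hne
  rcases lt_or_gt_of_ne (show toLex q ≠ toLex r from fun h => hne (toLex.injective h)) with h1 | h1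
  · exact (I.pointX_strictMono h1).ne h
  · exact (I.pointX_strictMono h1).ne' h

theorem exists_pointX_eq_mid {A : ℝ × ℝ} (hA : A ∈ I.intervals) :
    ∃ q, I.pointX q = intervalMid A := by
  rcases I.exists_leaf_or_mem_vertices hA with ⟨i, rfl⟩ | h
  · exact ⟨(i, true), rfl⟩
  · obtain ⟨k, hk, rfl⟩ := I.exists_eq_vertex h
    exact ⟨(k, false), (I.vertex_spec hk).2.symm⟩

/-! ### The matching of a partition -/

/-- The horizontal position of the two ends of the `k`-th strand of the tangle: for `k ≠ 0` these
are the midpoints of the two halves of the `k`-th vertex; the strand with `k = 0` comes from the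
top, represented by the position `0`, and ends at `1 / 2`. -/
noncomputable def strandEnd (q : Fin n × Bool) : ℝ :=
  if q.1.val = 0 then (if q.2 then 1 / 2 else 0) else intervalMid (halfInterval (I.vertex q.1) q.2)

theorem strandEnd_zero_false {k : Fin n} (hk : k.val = 0) : I.strandEnd (k, false) = 0 := by
  simp [strandEnd, hk]

theorem strandEnd_zero_true {k : Fin n} (hk : k.val = 0) : I.strandEnd (k, true) = 1 / 2 := by
  simp [strandEnd, hk]

theorem strandEnd_of_ne {k : Fin n} (hk : k.val ≠ 0) (b : Bool) :
    I.strandEnd (k, b) = intervalMid (halfInterval (I.vertex k) b) := by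
  simp [strandEnd, hk]

theorem intervalMid_pos {A : ℝ × ℝ} (h : IsStdDyadic A.1 A.2) : 0 < intervalMid A := by
  have h1 := h.lt
  have h2 := h.nonneg
  unfold intervalMid
  linarith

theorem intervalMid_half_ne {A : ℝ × ℝ} (h : IsStdDyadic A.1 A.2) (b : Bool) :
    intervalMid (halfInterval A b) ≠ 1 / 2 := by
  intro hm
  have h1 := intervalLen_halfInterval A b
  obtain ⟨h2, h3⟩ := (h.halfInterval b).mid_inj isStdDyadic_zero_one (hm.trans (by norm_num))
  have h4 := h.nonneg
  have h5 := h.le_one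
  unfold intervalLen at h1
  linarith

/-- All ends are midpoints of nodes other than the conventional value `0`, which no midpoint takes.
The value `1 / 2` belongs to the root alone, and any other node is a half of exactly one vertex. -/
theorem strandEnd_injective : Function.Injective I.strandEnd := by
  rintro ⟨k, b⟩ ⟨l, c⟩ h
  by_cases hk : k.val = 0 <;> by_cases hl : l.val = 0
  · have hkl : k = l := Fin.ext (hk.trans hl.symm)
    subst hkl
    cases b <;> cases c <;>
      simp [I.strandEnd_zero_false hk, I.strandEnd_zero_true hk] at h ⊢
  · rw [I.strandEnd_of_ne hl] at h
    have h1 := intervalMid_pos ((I.vertex_isStdDyadic hl).halfInterval c)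
    have h2 := intervalMid_half_ne (I.vertex_isStdDyadic hl) c
    cases b
    · rw [I.strandEnd_zero_false hk] at h
      exact absurd h h1.ne
    · rw [I.strandEnd_zero_true hk] at h
      exact absurd h h2.symm
  · rw [I.strandEnd_of_ne hk] at h
    have h1 := intervalMid_pos ((I.vertex_isStdDyadic hk).halfInterval b)
    have h2 := intervalMid_half_ne (I.vertex_isStdDyadic hk) b
    cases c
    · rw [I.strandEnd_zero_false hl] at h
      exact absurd h h1.ne'
    · rw [I.strandEnd_zero_true hl] at h
      exact absurd h h2
  · rw [I.strandEnd_of_ne hk, I.strandEnd_of_ne hl] at h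
    obtain ⟨h1, rfl⟩ :=
      (I.vertex_isStdDyadic hk).halfInterval_mid_inj (I.vertex_isStdDyadic hl) h
    have h2 := (I.vertex_spec hk).2
    rw [h1, (I.vertex_spec hl).2] at h2
    have := I.strictMono.injective h2
    rw [Fin.castSucc_injective n this]

theorem exists_pointX_eq_strandEnd (q : Fin n × Bool) : ∃ r, I.pointX r = I.strandEnd q := by
  obtain ⟨k, b⟩ := q
  by_cases hk : k.val = 0
  · cases b
    · exact ⟨(k, false), by rw [I.strandEnd_zero_false hk, pointX_false, I.castSucc_eq_zero hk]⟩
    · obtain ⟨r, hr⟩ := I.exists_pointX_eq_mid I.root_mem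
      exact ⟨r, by rw [hr, I.strandEnd_zero_true hk]; norm_num [intervalMid]⟩
  · rw [I.strandEnd_of_ne hk]
    exact I.exists_pointX_eq_mid (I.halfInterval_mem (I.vertex_spec hk).1 b)

/-- The permutation that takes `(k, b)` to the lower endpoint of the tangle at which the `k`-th
strand ends on the left (`b = false`) or on the right (`b = true`). The point `(0, false)` stands
for the top. -/
noncomputable def matching : Equiv.Perm (Fin n × Bool) :=
  Equiv.ofBijective (fun q => (I.exists_pointX_eq_strandEnd q).choose) <|
    Finite.injective_iff_bijective.1 fun q r h => I.strandEnd_injective <| by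
      rw [← (I.exists_pointX_eq_strandEnd q).choose_spec, ← (I.exists_pointX_eq_strandEnd r).choose_spec]
      exact congrArg I.pointX h

theorem pointX_matching (q : Fin n × Bool) : I.pointX (I.matching q) = I.strandEnd q :=
  (I.exists_pointX_eq_strandEnd q).choose_spec

theorem matching_zero {k : Fin n} (hk : k.val = 0) : I.matching (k, false) = (k, false) := by
  apply I.pointX_injective
  rw [pointX_matching, I.strandEnd_zero_false hk, pointX_false, I.castSucc_eq_zero hk]

/-- The ends of the strands are the midpoints of the nodes. -/
theorem exists_strandEnd_eq_mid {A : ℝ × ℝ} (hA : A ∈ I.intervals) :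
    ∃ q, I.strandEnd q = intervalMid A := by
  obtain ⟨r, hr⟩ := I.exists_pointX_eq_mid hA
  refine ⟨I.matching.symm r, ?_⟩
  rw [← pointX_matching, Equiv.apply_symm_apply, hr]

/-! ### Signs of the points -/

/-- The orientation of the lower endpoints of the tangle. -/
def pointSign (σ : Fin n → ℤˣ) (q : Fin n × Bool) : ℤˣ := if q.2 then -σ q.1 else σ q.1

/-- For a leaf this is the sign convention at `(i, true)`. For a vertex the point is the breakpoint
below it, and the statement is the sign rule. Leaves and vertices therefore behave uniformly. -/
theorem pointSign_of_mid {σ : Fin n → ℤˣ} (hσ : IsRegionSigning I σ) {A : ℝ × ℝ}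
    (hA : A ∈ I.intervals) {i : Fin n} (hi : A.1 = I.a i.castSucc) {q : Fin n × Bool}
    (hq : I.pointX q = intervalMid A) : pointSign σ q = -σ i := by
  rcases I.exists_leaf_or_mem_vertices hA with ⟨j, rfl⟩ | h
  · have hij : j = i := Fin.castSucc_injective n (I.strictMono.injective hi)
    subst hij
    rw [← pointX_true] at hq
    rw [I.pointX_injective hq]
    rfl
  · obtain ⟨k, hk, rfl⟩ := I.exists_eq_vertex h
    obtain ⟨j, hj⟩ := hA.2.1
    have hkm := (I.vertex_spec hk).2
    rw [hkm, ← pointX_false] at hq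
    rw [I.pointX_injective hq]
    refine hσ.2 i k j ?_ ?_
    · rw [hj, ← hi]; exact hA.2.2
    · rw [hj, ← hi, ← hkm]; rfl

/-- If vertex `k` is `[a i, a j]`, its halves start at `a i` and `a k`, so the strand ends have
signs `-σ i = σ k` and `-σ k`. Strand `0` ends below the root, with sign `-σ 0`. -/
theorem pointSign_matching {σ : Fin n → ℤˣ} (hσ : IsRegionSigning I σ) (q : Fin n × Bool) :
    pointSign σ (I.matching q) = pointSign σ q := by
  obtain ⟨k, b⟩ := q
  have hp := I.pointX_matching (k, b)
  by_cases hk : k.val = 0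
  · cases b
    · rw [I.matching_zero hk]
    · rw [I.strandEnd_zero_true hk] at hp
      exact I.pointSign_of_mid hσ I.root_mem (i := k) (I.castSucc_eq_zero hk).symm
        (hp.trans (by norm_num [intervalMid]))
  · rw [I.strandEnd_of_ne hk] at hp
    obtain ⟨hv, hm⟩ := I.vertex_spec hk
    have hmem := I.halfInterval_mem hv b
    have h1 := hv.1.2.2
    cases b
    · have hlt := h1.lt
      have hle := h1.le_one
      obtain ⟨i, hi⟩ := I.exists_left hv.1.1 (by linarith)
      obtain ⟨j, hj⟩ := hv.1.2.1
      rw [I.pointSign_of_mid hσ hmem hi.symm hp]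
      refine (hσ.2 i k j ?_ ?_).symm
      · rw [hi, hj]; exact h1
      · rw [hi, hj, ← hm]; rfl
    · exact I.pointSign_of_mid hσ hmem hm hp

/-! ### Connectivity of the matching -/

/-- Induction on the number of subintervals in the node. At a vertex `k`, the left half leads to `i`
and the right half to `k`; strand `k` joins the points below the two halves and thereby links `k` to
`i`. -/
theorem eqvGen_baseRel_of_mid {A : ℝ × ℝ} (hA : A ∈ I.intervals) {i : Fin n}
    (hi : A.1 = I.a i.castSucc) {q : Fin n × Bool} (hq : I.pointX q = intervalMid A) :
    Relation.EqvGen (BaseRel I.matching) q.1 i := by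
  obtain ⟨j, hj⟩ := hA.2.1
  induction hd : j.val - i.val using Nat.strong_induction_on generalizing A i j q with
  | _ d ih =>
  rcases I.exists_leaf_or_mem_vertices hA with ⟨l, rfl⟩ | h
  · have hij : l = i := Fin.castSucc_injective n (I.strictMono.injective hi)
    subst hij
    rw [← pointX_true] at hq
    rw [I.pointX_injective hq]
    exact Relation.EqvGen.refl _
  · obtain ⟨k, hk, rfl⟩ := I.exists_eq_vertex h
    have hkm := (I.vertex_spec hk).2
    have hlt := hA.2.2.lt
    rw [hkm, ← pointX_false] at hq
    rw [I.pointX_injective hq]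
    have hik : i < k := by
      rw [← Fin.castSucc_lt_castSucc_iff, ← I.strictMono.lt_iff_lt, ← hkm, ← hi]
      unfold intervalMid; linarith
    have hkj : k.castSucc < j := by
      rw [← I.strictMono.lt_iff_lt, ← hkm, hj]
      unfold intervalMid; linarith
    rw [Fin.lt_def] at hik hkj
    rw [Fin.val_castSucc] at hkj
    have hL := ih (k.val - i.val) (by omega) (I.halfInterval_mem h false) (i := i) hi
      (q := I.matching (k, false)) (by rw [pointX_matching, I.strandEnd_of_ne hk]) k.castSucc hkm.symm
      rfl
    have hR := ih (j.val - k.val) (by omega) (I.halfInterval_mem h true) (i := k) hkm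
      (q := I.matching (k, true)) (by rw [pointX_matching, I.strandEnd_of_ne hk]) j hj rfl
    exact (((hR.symm _ _).trans _ _ _ ((Relation.EqvGen.rel _ _ ⟨k, rfl, rfl⟩).symm _ _)).trans _ _ _ hL)

/-- Each `k ≠ 0` is linked to the index of the left end of vertex `k`, which is smaller, so descent
reaches `0`. -/
theorem eqvGen_baseRel (i j : Fin n) : Relation.EqvGen (BaseRel I.matching) i j := by
  have key : ∀ k : Fin n, Relation.EqvGen (BaseRel I.matching) k ⟨0, I.pos⟩ := by
    intro k
    induction hd : k.val using Nat.strong_induction_on generalizing k with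
    | _ d ih =>
    by_cases hk : k.val = 0
    · rw [show k = ⟨0, I.pos⟩ from Fin.ext hk]
      exact Relation.EqvGen.refl _
    · obtain ⟨hv, hm⟩ := I.vertex_spec hk
      have hlt := hv.1.2.2.lt
      have hle := hv.1.2.2.le_one
      obtain ⟨l, hl⟩ := I.exists_left hv.1.1 (by linarith)
      have hlk : l < k := by
        rw [← Fin.castSucc_lt_castSucc_iff, ← I.strictMono.lt_iff_lt, ← hm, hl]
        unfold intervalMid; linarith
      exact (I.eqvGen_baseRel_of_mid hv.1 hl.symm (q := (k, false)) hm.symm).trans _ _ _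
        (ih l.val (by rw [Fin.lt_def] at hlk; omega) l rfl)
  exact (key i).trans _ _ _ ((key j).symm _ _)

end SDPartition

/-- The number of cycles of the matchings of two partitions with the same signs has the parity of
the number of subintervals. -/
theorem card_quot_matchRel_matching {n : ℕ} {I J : SDPartition n} {σ : Fin n → ℤˣ}
    (hI : IsRegionSigning I σ) (hJ : IsRegionSigning J σ) :
    Nat.card (Quot (MatchRel I.matching J.matching)) ≡ n [MOD 2] := by
  -- A single orientation serves both matchings because the two trees have the same signs.
  refine card_quot_matchRel (o := fun q => decide (SDPartition.pointSign σ q = 1)) ?_ I.pos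
    (fun q => by simp only [I.pointSign_matching hI]) (fun q => by simp only [J.pointSign_matching hJ])
    I.eqvGen_baseRel J.eqvGen_baseRel
  intro k b
  rcases Int.units_eq_one_or (σ k) with h | h <;> cases b <;>
    simp [SDPartition.pointSign, h]

/-! ### Segments in space -/

/-- A segment as the set of solutions of linear equations, parametrized by an affine function that
goes from `0` to `1`. -/
theorem mem_segment_space {p : ℝ × ℝ × ℝ} {x y z x' y' z' : ℝ} :
    p ∈ segment ℝ (x, y, z) (x', y', z') ↔ ∃ t, 0 ≤ t ∧ t ≤ 1 ∧ p.1 = x + t * (x' - x) ∧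
      p.2.1 = y + t * (y' - y) ∧ p.2.2 = z + t * (z' - z) := by
  rw [segment_eq_image']
  simp only [mem_image, mem_Icc, Prod.ext_iff, Prod.fst_add, Prod.snd_add, Prod.smul_fst,
    Prod.smul_snd, Prod.fst_sub, Prod.snd_sub, smul_eq_mul]
  constructor
  · rintro ⟨t, ⟨h0, h1⟩, hx, hy, hz⟩
    exact ⟨t, h0, h1, hx.symm, hy.symm, hz.symm⟩
  · rintro ⟨t, h0, h1, hx, hy, hz⟩
    exact ⟨t, ⟨h0, h1⟩, hx.symm, hy.symm, hz.symm⟩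

theorem mem_vertical_segment {p : ℝ × ℝ × ℝ} {x y y' : ℝ} (h : y' < y) :
    p ∈ segment ℝ (x, y, 0) (x, y', 0) ↔ p.1 = x ∧ y' ≤ p.2.1 ∧ p.2.1 ≤ y ∧ p.2.2 = 0 := by
  rw [mem_segment_space]
  constructor
  · rintro ⟨t, h0, h1, hx, hy, hz⟩
    refine ⟨by linarith, ?_, ?_, by linarith⟩ <;> rw [hy] <;> nlinarith
  · rintro ⟨hx, hy, hy', hz⟩
    have h2 : 0 < y - y' := sub_pos.2 h
    refine ⟨(y - p.2.1) / (y - y'), div_nonneg (by linarith) h2.le,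
      (div_le_one h2).2 (by linarith), by rw [hx]; ring, ?_, by rw [hz]; ring⟩
    field_simp
    ring

theorem mem_horizontal_segment {p : ℝ × ℝ × ℝ} {x x' y : ℝ} (h : x' < x) :
    p ∈ segment ℝ (x, y, 0) (x', y, 0) ↔ x' ≤ p.1 ∧ p.1 ≤ x ∧ p.2.1 = y ∧ p.2.2 = 0 := by
  rw [mem_segment_space]
  constructor
  · rintro ⟨t, h0, h1, hx, hy, hz⟩
    refine ⟨?_, ?_, by linarith, by linarith⟩ <;> rw [hx] <;> nlinarith
  · rintro ⟨hx, hx', hy, hz⟩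
    have h2 : 0 < x - x' := sub_pos.2 h
    refine ⟨(x - p.1) / (x - x'), div_nonneg (by linarith) h2.le,
      (div_le_one h2).2 (by linarith), ?_, by rw [hy]; ring, by rw [hz]; ring⟩
    field_simp
    ring

theorem mem_over_segment {p : ℝ × ℝ × ℝ} {x x' y y' : ℝ} :
    p ∈ segment ℝ (x, y, 1) (x', y', 0) ↔ 0 ≤ p.2.2 ∧ p.2.2 ≤ 1 ∧
      p.1 = x + (1 - p.2.2) * (x' - x) ∧ p.2.1 = y + (1 - p.2.2) * (y' - y) := by
  rw [mem_segment_space]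
  constructor
  · rintro ⟨t, h0, h1, hx, hy, hz⟩
    have ht : 1 - p.2.2 = t := by linarith
    rw [ht]
    exact ⟨by linarith, by linarith, hx, hy⟩
  · rintro ⟨h0, h1, hx, hy⟩
    exact ⟨1 - p.2.2, by linarith, by linarith, hx, hy, by ring⟩

theorem mem_shift_segment {p : ℝ × ℝ × ℝ} {x x' : ℝ} :
    p ∈ segment ℝ (x, 0, 0) (x', -1, 0) ↔
      -1 ≤ p.2.1 ∧ p.2.1 ≤ 0 ∧ p.1 = x - p.2.1 * (x' - x) ∧ p.2.2 = 0 := by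
  rw [mem_segment_space]
  constructor
  · rintro ⟨t, h0, h1, hx, hy, hz⟩
    have ht : p.2.1 = -t := by linarith
    rw [ht]
    exact ⟨by linarith, by linarith, by linarith, by linarith⟩
  · rintro ⟨h0, h1, hx, hz⟩
    exact ⟨-p.2.1, by linarith, by linarith, by linarith, by ring, by linarith⟩

theorem mem_closingArc {p : ℝ × ℝ × ℝ} :
    p ∈ closingArc ↔ p.2.2 = 0 ∧ ((p.2.1 = 2 ∧ -1 ≤ p.1 ∧ p.1 ≤ 1 / 2) ∨
      (p.1 = -1 ∧ -3 ≤ p.2.1 ∧ p.2.1 ≤ 2) ∨ (p.2.1 = -3 ∧ -1 ≤ p.1 ∧ p.1 ≤ 1 / 2)) := by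
  unfold closingArc
  rw [segment_symm ℝ (-1, -3, 0) (1 / 2, -3, 0), mem_union, mem_union,
    mem_horizontal_segment (by norm_num), mem_vertical_segment (by norm_num),
    mem_horizontal_segment (by norm_num)]
  tauto

theorem isClosed_segment_space (a b : ℝ × ℝ × ℝ) : IsClosed (segment ℝ a b) := by
  rw [segment_eq_image']
  exact (isCompact_Icc.image (by fun_prop)).isClosed

theorem isConnected_segment_space (a b : ℝ × ℝ × ℝ) : IsConnected (segment ℝ a b) :=
  ⟨⟨a, left_mem_segment ℝ a b⟩, (convex_segment a b).isPreconnected⟩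

/-! ### The mirror -/

theorem vmirror_vmirror (p : ℝ × ℝ × ℝ) : vmirror (vmirror p) = p := by
  simp [vmirror]

theorem continuous_vmirror : Continuous vmirror := by
  unfold vmirror
  fun_prop

theorem image_vmirror (s : Set (ℝ × ℝ × ℝ)) : vmirror '' s = vmirror ⁻¹' s :=
  congrFun (image_eq_preimage_of_inverse vmirror_vmirror vmirror_vmirror) s

namespace SDPartition

variable {n : ℕ} (I J : SDPartition n)

/-! ### The strands of the tangle -/

/-- The `k`-th strand of the tangle of `I`: for `k ≠ 0` it contains the over-strand at the `k`-th
vertex, and for `k = 0` it comes from the top. -/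
noncomputable def strand (k : Fin n) : Set (ℝ × ℝ × ℝ) :=
  if k.val = 0 then segment ℝ (1 / 2, 2, 0) (1 / 2, 0, 0) else
    (segment ℝ (intervalMid (I.vertex k), intervalLen (I.vertex k), 1)
        (I.strandEnd (k, false), intervalLen (I.vertex k) / 2, 0) ∪
      segment ℝ (intervalMid (I.vertex k), intervalLen (I.vertex k), 1)
        (I.strandEnd (k, true), intervalLen (I.vertex k) / 2, 0)) ∪
    segment ℝ (I.strandEnd (k, false), intervalLen (I.vertex k) / 2, 0)
        (I.strandEnd (k, false), 0, 0) ∪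
    segment ℝ (I.strandEnd (k, true), intervalLen (I.vertex k) / 2, 0)
        (I.strandEnd (k, true), 0, 0)

theorem isClosed_strand (k : Fin n) : IsClosed (I.strand k) := by
  unfold strand
  split_ifs
  · exact isClosed_segment_space _ _
  · exact (((isClosed_segment_space _ _).union (isClosed_segment_space _ _)).union
      (isClosed_segment_space _ _)).union (isClosed_segment_space _ _)

theorem isConnected_strand (k : Fin n) : IsConnected (I.strand k) := by
  unfold strand
  split_ifs
  · exact isConnected_segment_space _ _
  · refine IsConnected.union ?_ (IsConnected.union ?_ (IsConnected.union ?_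
      (isConnected_segment_space _ _) (isConnected_segment_space _ _))
      (isConnected_segment_space _ _)) (isConnected_segment_space _ _)
    · exact ⟨_, Or.inl (Or.inr (right_mem_segment ℝ _ _)), left_mem_segment ℝ _ _⟩
    · exact ⟨_, Or.inl (right_mem_segment ℝ _ _), left_mem_segment ℝ _ _⟩
    · exact ⟨_, left_mem_segment ℝ _ _, left_mem_segment ℝ _ _⟩

theorem intervalLen_vertex_pos {k : Fin n} (hk : k.val ≠ 0) : 0 < intervalLen (I.vertex k) :=
  sub_pos.2 (I.vertex_isStdDyadic hk).lt

theorem intervalLen_vertex_le {k : Fin n} (hk : k.val ≠ 0) : intervalLen (I.vertex k) ≤ 1 := by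
  have h1 := (I.vertex_isStdDyadic hk).le_one
  have h2 := (I.vertex_isStdDyadic hk).nonneg
  unfold intervalLen
  linarith

theorem strandEnd_false_of_ne {k : Fin n} (hk : k.val ≠ 0) :
    I.strandEnd (k, false) = intervalMid (I.vertex k) - intervalLen (I.vertex k) / 4 := by
  rw [I.strandEnd_of_ne hk, intervalMid_halfInterval_false]

theorem strandEnd_true_of_ne {k : Fin n} (hk : k.val ≠ 0) :
    I.strandEnd (k, true) = intervalMid (I.vertex k) + intervalLen (I.vertex k) / 4 := by
  rw [I.strandEnd_of_ne hk, intervalMid_halfInterval_true]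

theorem mem_strand_zero {k : Fin n} (hk : k.val = 0) {p : ℝ × ℝ × ℝ} :
    p ∈ I.strand k ↔ p.1 = 1 / 2 ∧ 0 ≤ p.2.1 ∧ p.2.1 ≤ 2 ∧ p.2.2 = 0 := by
  unfold strand
  rw [if_pos hk, mem_vertical_segment (by norm_num)]

theorem mem_strand_of_ne {k : Fin n} (hk : k.val ≠ 0) {p : ℝ × ℝ × ℝ} :
    p ∈ I.strand k ↔
      (0 ≤ p.2.2 ∧ p.2.2 ≤ 1 ∧ p.2.1 = intervalLen (I.vertex k) * (1 + p.2.2) / 2 ∧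
        (p.1 = intervalMid (I.vertex k) - intervalLen (I.vertex k) / 4 * (1 - p.2.2) ∨
          p.1 = intervalMid (I.vertex k) + intervalLen (I.vertex k) / 4 * (1 - p.2.2))) ∨
      ∃ b, p.1 = I.strandEnd (k, b) ∧ 0 ≤ p.2.1 ∧ p.2.1 ≤ intervalLen (I.vertex k) / 2 ∧
        p.2.2 = 0 := by
  have hpos := I.intervalLen_vertex_pos hk
  unfold strand
  rw [if_neg hk, mem_union, mem_union, mem_union, mem_over_segment, mem_over_segment,
    mem_vertical_segment (by linarith), mem_vertical_segment (by linarith), Bool.exists_bool,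
    or_assoc, I.strandEnd_false_of_ne hk, I.strandEnd_true_of_ne hk]
  refine or_congr ?_ Iff.rfl
  constructor
  · rintro (⟨h0, h1, hx, hy⟩ | ⟨h0, h1, hx, hy⟩)
    · exact ⟨h0, h1, by linarith, Or.inl (by linarith)⟩
    · exact ⟨h0, h1, by linarith, Or.inr (by linarith)⟩
  · rintro ⟨h0, h1, hy, hx | hx⟩
    · exact Or.inl ⟨h0, h1, by linarith, by linarith⟩
    · exact Or.inr ⟨h0, h1, by linarith, by linarith⟩

theorem exists_strandEnd_of_mem_strand {k : Fin n} {p : ℝ × ℝ × ℝ} (hp : p ∈ I.strand k)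
    (hz : p.2.2 = 0) : ∃ b, p.1 = I.strandEnd (k, b) := by
  by_cases hk : k.val = 0
  · exact ⟨true, by rw [I.strandEnd_zero_true hk, ((I.mem_strand_zero hk).1 hp).1]⟩
  · rcases (I.mem_strand_of_ne hk).1 hp with ⟨-, -, -, hx | hx⟩ | ⟨b, hb, -⟩
    · exact ⟨false, by rw [hx, hz, I.strandEnd_false_of_ne hk]; ring⟩
    · exact ⟨true, by rw [hx, hz, I.strandEnd_true_of_ne hk]; ring⟩
    · exact ⟨b, hb⟩

theorem over_of_mem_strand {k : Fin n} {p : ℝ × ℝ × ℝ} (hp : p ∈ I.strand k) (hz : p.2.2 ≠ 0) :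
    k.val ≠ 0 ∧ 0 ≤ p.2.2 ∧ p.2.1 = intervalLen (I.vertex k) * (1 + p.2.2) / 2 ∧
      |p.1 - intervalMid (I.vertex k)| ≤ intervalLen (I.vertex k) / 4 := by
  by_cases hk : k.val = 0
  · exact absurd ((I.mem_strand_zero hk).1 hp).2.2.2 hz
  · have hpos := I.intervalLen_vertex_pos hk
    rcases (I.mem_strand_of_ne hk).1 hp with ⟨h0, h1, hy, hx⟩ | ⟨b, -, -, -, hb⟩
    · refine ⟨hk, h0, hy, ?_⟩
      rw [abs_le]
      rcases hx with hx | hx <;> rw [hx] <;> constructor <;> nlinarith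
    · exact absurd hb hz

theorem strandEnd_pos {k : Fin n} {b : Bool} (h : k.val ≠ 0 ∨ b = true) :
    0 < I.strandEnd (k, b) := by
  by_cases hk : k.val = 0
  · rcases h with h | rfl
    · exact absurd hk h
    · rw [I.strandEnd_zero_true hk]; norm_num
  · rw [I.strandEnd_of_ne hk]
    exact intervalMid_pos ((I.vertex_isStdDyadic hk).halfInterval b)

theorem bounds_of_mem_strand {k : Fin n} {p : ℝ × ℝ × ℝ} (hp : p ∈ I.strand k) :
    0 < p.1 ∧ 0 ≤ p.2.1 ∧ (p.2.1 = 0 → p.2.2 = 0) ∧ (1 < p.2.1 → k.val = 0) := by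
  by_cases hk : k.val = 0
  · obtain ⟨hx, hy, -, hz⟩ := (I.mem_strand_zero hk).1 hp
    exact ⟨by rw [hx]; norm_num, hy, fun _ => hz, fun _ => hk⟩
  · have hpos := I.intervalLen_vertex_pos hk
    have hle := I.intervalLen_vertex_le hk
    have hf := I.strandEnd_pos (k := k) (b := false) (Or.inl hk)
    have ht := I.strandEnd_pos (k := k) (b := true) (Or.inl hk)
    rw [I.strandEnd_false_of_ne hk] at hf
    rcases (I.mem_strand_of_ne hk).1 hp with ⟨h0, h1, hy, hx⟩ | ⟨b, hx, hy, hy', hz⟩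
    · refine ⟨?_, by rw [hy]; positivity, fun h => ?_, fun h => ?_⟩
      · rcases hx with hx | hx <;> rw [hx] <;> nlinarith
      · exfalso
        rw [hy] at h
        nlinarith
      · exfalso
        rw [hy] at h
        nlinarith
    · exact ⟨by rw [hx]; exact I.strandEnd_pos (Or.inl hk), hy, fun _ => hz,
        fun h => by exfalso; linarith⟩

/-- At height `z = 0` a strand lies above its own ends, and the ends of different strands differ.
Where `z ≠ 0`, only over-strands occur. -/
theorem strand_inter {k l : Fin n} (h : (I.strand k ∩ I.strand l).Nonempty) : k = l := by
  obtain ⟨p, hk, hl⟩ := h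
  by_cases hz : p.2.2 = 0
  · obtain ⟨b, hb⟩ := I.exists_strandEnd_of_mem_strand hk hz
    obtain ⟨c, hc⟩ := I.exists_strandEnd_of_mem_strand hl hz
    exact congrArg Prod.fst (I.strandEnd_injective (hb.symm.trans hc))
  · obtain ⟨hk0, h0, hy, hx⟩ := I.over_of_mem_strand hk hz
    obtain ⟨hl0, -, hy', hx'⟩ := I.over_of_mem_strand hl hz
    -- On an over-strand `y` and `z` determine the length of the vertex; two vertices of equal
    -- length whose over-strands meet must overlap, hence agree.
    have hlen : intervalLen (I.vertex k) = intervalLen (I.vertex l) := by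
      have h1 : (0 : ℝ) < 1 + p.2.2 := by linarith
      have h2 := hy.symm.trans hy'
      apply mul_right_cancel₀ h1.ne'
      linarith
    have hpos := I.intervalLen_vertex_pos hk0
    rw [abs_le] at hx hx'
    have e := (I.vertex_isStdDyadic hk0).eq_of_length (I.vertex_isStdDyadic hl0) hlen
    unfold intervalLen intervalMid at *
    obtain ⟨e1, e2⟩ := e (by linarith) (by linarith)
    have h1 := (I.vertex_spec hk0).2
    rw [Prod.ext e1 e2, (I.vertex_spec hl0).2] at h1
    exact (Fin.castSucc_injective n (I.strictMono.injective h1)).symm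

/-- The vertical line below a node belongs to the strand ending at the node's midpoint: strand `0`
for the root, the strand of the parent vertex otherwise. -/
theorem tangle_eq_iUnion_strand : tangle I = ⋃ k, I.strand k := by
  apply Subset.antisymm
  · refine union_subset (union_subset ?_ ?_) ?_
    · intro p hp
      rw [mem_vertical_segment (by norm_num)] at hp
      exact mem_iUnion.2 ⟨⟨0, I.pos⟩, (I.mem_strand_zero rfl).2
        ⟨hp.1, by linarith [hp.2.1], hp.2.2⟩⟩
    · refine iUnion₂_subset fun B hB => ?_
      obtain ⟨k, hk, rfl⟩ := I.exists_eq_vertex hB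
      refine Subset.trans ?_ (subset_iUnion _ k)
      unfold strand
      rw [if_neg hk, I.strandEnd_false_of_ne hk, I.strandEnd_true_of_ne hk]
      exact subset_union_left.trans subset_union_left
    · refine iUnion₂_subset fun A hA => ?_
      obtain ⟨⟨k, b⟩, hq⟩ := I.exists_strandEnd_eq_mid hA
      refine Subset.trans ?_ (subset_iUnion _ k)
      intro p hp
      have hlt := hA.2.2.lt
      have h0 := hA.2.2.nonneg
      have h1 := hA.2.2.le_one
      have hl : 0 < intervalLen A := sub_pos.2 hlt
      rw [mem_vertical_segment hl] at hp
      by_cases hk : k.val = 0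
      · cases b
        · rw [I.strandEnd_zero_false hk] at hq
          exact absurd hq (intervalMid_pos hA.2.2).ne
        · rw [I.strandEnd_zero_true hk] at hq
          refine (I.mem_strand_zero hk).2 ⟨hp.1.trans hq.symm, hp.2.1, ?_, hp.2.2.2⟩
          have := hp.2.2.1
          unfold intervalLen at this
          linarith
      · refine (I.mem_strand_of_ne hk).2 (Or.inr ⟨b, hp.1.trans hq.symm, hp.2.1, ?_, hp.2.2.2⟩)
        rw [I.strandEnd_of_ne hk] at hq
        obtain ⟨e1, e2⟩ := ((I.vertex_isStdDyadic hk).halfInterval b).mid_inj hA.2.2 hq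
        rw [← intervalLen_halfInterval _ b]
        unfold intervalLen at hp ⊢
        rw [e1, e2]
        exact hp.2.2.1
  · refine iUnion_subset fun k => ?_
    by_cases hk : k.val = 0
    · intro p hp
      obtain ⟨hx, hy, hy', hz⟩ := (I.mem_strand_zero hk).1 hp
      rcases le_total 1 p.2.1 with h | h
      · exact Or.inl (Or.inl ((mem_vertical_segment (by norm_num)).2 ⟨hx, h, hy', hz⟩))
      · refine Or.inr (mem_iUnion₂.2 ⟨(0, 1), I.root_mem, ?_⟩)
        have hl : intervalLen (0, 1) = 1 := by norm_num [intervalLen]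
        rw [hl, mem_vertical_segment (by norm_num)]
        exact ⟨hx.trans (by norm_num [intervalMid]), hy, h, hz⟩
    · have hv := (I.vertex_spec hk).1
      have hover := subset_iUnion₂ (s := fun B (_ : B ∈ I.vertices) =>
        segment ℝ (intervalMid B, intervalLen B, (1 : ℝ))
          (intervalMid B - intervalLen B / 4, intervalLen B / 2, 0) ∪
        segment ℝ (intervalMid B, intervalLen B, 1)
          (intervalMid B + intervalLen B / 4, intervalLen B / 2, 0)) (I.vertex k) hv
      have hunder := fun b => subset_iUnion₂ (s := fun A (_ : A ∈ I.intervals) =>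
        segment ℝ (intervalMid A, intervalLen A, (0 : ℝ)) (intervalMid A, 0, 0))
          (halfInterval (I.vertex k) b) (I.halfInterval_mem hv b)
      simp only [intervalLen_halfInterval, ← I.strandEnd_of_ne hk] at hunder
      simp only [← I.strandEnd_false_of_ne hk, ← I.strandEnd_true_of_ne hk] at hover
      unfold strand
      rw [if_neg hk]
      refine union_subset (union_subset ?_ ?_) ?_
      · exact hover.trans (subset_union_right.trans subset_union_left)
      · exact (hunder false).trans subset_union_right
      · exact (hunder true).trans subset_union_right

/-! ### The wires -/

/-- The arc that joins the point `q` below the tangle of `I` to the point `q` above the mirrored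
tangle of `J`; for `q = (0, false)` this is the closing arc. -/
noncomputable def wire (q : Fin n × Bool) : Set (ℝ × ℝ × ℝ) :=
  if q.1.val = 0 ∧ q.2 = false then closingArc else
    segment ℝ (I.pointX q, 0, 0) (J.pointX q, -1, 0)

theorem wire_zero {k : Fin n} (hk : k.val = 0) : I.wire J (k, false) = closingArc := by
  simp [wire, hk]

theorem mem_wire_of_ne {q : Fin n × Bool} (hq : ¬ (q.1.val = 0 ∧ q.2 = false))
    {p : ℝ × ℝ × ℝ} : p ∈ I.wire J q ↔ -1 ≤ p.2.1 ∧ p.2.1 ≤ 0 ∧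
      p.1 = I.pointX q - p.2.1 * (J.pointX q - I.pointX q) ∧ p.2.2 = 0 := by
  unfold wire
  rw [if_neg hq, mem_shift_segment]

theorem isClosed_wire (q : Fin n × Bool) : IsClosed (I.wire J q) := by
  unfold wire
  split_ifs
  · exact ((isClosed_segment_space _ _).union (isClosed_segment_space _ _)).union
      (isClosed_segment_space _ _)
  · exact isClosed_segment_space _ _

theorem isConnected_wire (q : Fin n × Bool) : IsConnected (I.wire J q) := by
  unfold wire
  split_ifs
  · refine IsConnected.union ?_ (IsConnected.union ?_
      (isConnected_segment_space _ _) (isConnected_segment_space _ _))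
      (isConnected_segment_space _ _)
    · exact ⟨_, Or.inr (right_mem_segment ℝ _ _), left_mem_segment ℝ _ _⟩
    · exact ⟨_, right_mem_segment ℝ _ _, left_mem_segment ℝ _ _⟩
  · exact isConnected_segment_space _ _

/-- The mirror exchanges the roles of `I` and `J`, so what is proved about the upper tangle and the
wires transfers to the lower tangle. -/
theorem vmirror_mem_wire {q : Fin n × Bool} {p : ℝ × ℝ × ℝ} :
    vmirror p ∈ J.wire I q ↔ p ∈ I.wire J q := by
  by_cases hq : q.1.val = 0 ∧ q.2 = false
  · unfold wire
    rw [if_pos hq, if_pos hq, mem_closingArc, mem_closingArc]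
    dsimp only [vmirror]
    refine and_congr Iff.rfl ⟨?_, ?_⟩
    · rintro (⟨h1, h2, h3⟩ | ⟨h1, h2, h3⟩ | ⟨h1, h2, h3⟩)
      · exact Or.inr (Or.inr ⟨by linarith, h2, h3⟩)
      · exact Or.inr (Or.inl ⟨h1, by linarith, by linarith⟩)
      · exact Or.inl ⟨by linarith, h2, h3⟩
    · rintro (⟨h1, h2, h3⟩ | ⟨h1, h2, h3⟩ | ⟨h1, h2, h3⟩)
      · exact Or.inr (Or.inr ⟨by linarith, h2, h3⟩)
      · exact Or.inr (Or.inl ⟨h1, by linarith, by linarith⟩)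
      · exact Or.inl ⟨by linarith, h2, h3⟩
  · rw [J.mem_wire_of_ne I hq, I.mem_wire_of_ne J hq]
    dsimp only [vmirror]
    constructor <;> rintro ⟨h1, h2, h3, h4⟩ <;>
      exact ⟨by linarith, by linarith, by linarith, h4⟩

theorem pointX_nonneg (q : Fin n × Bool) : 0 ≤ I.pointX q :=
  (I.mem_Icc _).1.trans (I.le_pointX q)

theorem not_mem_closingArc_of_mem_wire {q : Fin n × Bool} (hq : ¬ (q.1.val = 0 ∧ q.2 = false))
    {p : ℝ × ℝ × ℝ} (hp : p ∈ I.wire J q) : p ∉ closingArc := by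
  obtain ⟨h1, h2, h3, -⟩ := (I.mem_wire_of_ne J hq).1 hp
  have hI := I.pointX_nonneg q
  have hJ := J.pointX_nonneg q
  have hx : 0 ≤ p.1 := by rw [h3]; nlinarith
  rw [mem_closingArc]
  rintro ⟨-, ⟨h, -⟩ | ⟨h, -⟩ | ⟨h, -⟩⟩ <;> linarith

/-- At each height the positions of two straight wires are the same convex combination of their
ends, which are ordered alike at both levels. The closing arc stays at `x = -1` in this strip. -/
theorem disjoint_wire_of_lt {q r : Fin n × Bool} (h : toLex q < toLex r) {p : ℝ × ℝ × ℝ}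
    (hq : p ∈ I.wire J q) (hr : p ∈ I.wire J r) : False := by
  by_cases hq0 : q.1.val = 0 ∧ q.2 = false <;> by_cases hr0 : r.1.val = 0 ∧ r.2 = false
  · have : q = r := Prod.ext (Fin.ext (hq0.1.trans hr0.1.symm)) (hq0.2.trans hr0.2.symm)
    rw [this] at h
    exact lt_irrefl _ h
  · refine I.not_mem_closingArc_of_mem_wire J hr0 hr ?_
    unfold wire at hq
    rwa [if_pos hq0] at hq
  · refine I.not_mem_closingArc_of_mem_wire J hq0 hq ?_
    unfold wire at hr
    rwa [if_pos hr0] at hr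
  · have hI := I.pointX_strictMono h
    have hJ := J.pointX_strictMono h
    obtain ⟨h1, h2, h3, -⟩ := (I.mem_wire_of_ne J hq0).1 hq
    obtain ⟨-, -, h4, -⟩ := (I.mem_wire_of_ne J hr0).1 hr
    have h5 : (1 + p.2.1) * (I.pointX r - I.pointX q) + -p.2.1 * (J.pointX r - J.pointX q) = 0 := by
      linarith
    -- The weights `1 + y` and `-y` are nonnegative and not both zero; the case `y = -1` is where
    -- the first vanishes.
    rcases h1.eq_or_lt with h6 | h6 <;> nlinarith

theorem wire_inter {q r : Fin n × Bool} (h : (I.wire J q ∩ I.wire J r).Nonempty) : q = r := by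
  obtain ⟨p, hq, hr⟩ := h
  by_contra hne
  rcases lt_or_gt_of_ne (show toLex q ≠ toLex r from fun h => hne (toLex.injective h)) with h1 | h1
  · exact I.disjoint_wire_of_lt J h1 hq hr
  · exact I.disjoint_wire_of_lt J h1 hr hq

/-- Strands have `y ≥ 0` and straight wires `y ≤ 0`, so they meet only at `y = 0`, at an end of the
strand. Since strands have `x > 0`, the closing arc can meet them only at `y = 2`, a height reached
by strand `0` alone; this is the convention `matching_zero`. -/
theorem strand_inter_wire {k : Fin n} {q : Fin n × Bool} :
    (I.strand k ∩ I.wire J q).Nonempty ↔ ∃ b, q = I.matching (k, b) := by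
  constructor
  · rintro ⟨p, hk, hq⟩
    obtain ⟨hx, hy, hz, hk0⟩ := I.bounds_of_mem_strand hk
    by_cases hq0 : q.1.val = 0 ∧ q.2 = false
    · unfold wire at hq
      rw [if_pos hq0, mem_closingArc] at hq
      have hy2 : p.2.1 = 2 := by
        rcases hq.2 with ⟨h, -⟩ | ⟨h, -⟩ | ⟨h, -⟩ <;> linarith
      have hk1 := hk0 (by linarith)
      refine ⟨false, ?_⟩
      rw [I.matching_zero hk1]
      exact Prod.ext (Fin.ext (hq0.1.trans hk1.symm)) hq0.2
    · obtain ⟨-, h2, h3, h4⟩ := (I.mem_wire_of_ne J hq0).1 hq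
      have hy0 : p.2.1 = 0 := le_antisymm h2 hy
      obtain ⟨b, hb⟩ := I.exists_strandEnd_of_mem_strand hk h4
      refine ⟨b, I.pointX_injective ?_⟩
      rw [I.pointX_matching, ← hb, h3, hy0]
      ring
  · rintro ⟨b, rfl⟩
    by_cases h : k.val = 0 ∧ b = false
    · obtain ⟨hk, rfl⟩ := h
      rw [I.matching_zero hk, I.wire_zero J hk]
      refine ⟨(1 / 2, 2, 0), (I.mem_strand_zero hk).2 ⟨rfl, ?_, ?_, rfl⟩,
        mem_closingArc.2 ⟨rfl, Or.inl ⟨rfl, ?_, le_rfl⟩⟩⟩ <;> norm_num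
    · refine ⟨(I.strandEnd (k, b), 0, 0), ?_, ?_⟩
      · by_cases hk : k.val = 0
        · have hb : b = true := by simpa [hk] using h
          subst hb
          refine (I.mem_strand_zero hk).2 ⟨I.strandEnd_zero_true hk, le_rfl, by norm_num, rfl⟩
        · have := I.intervalLen_vertex_pos hk
          exact (I.mem_strand_of_ne hk).2 (Or.inr ⟨b, rfl, le_rfl, by positivity, rfl⟩)
      · refine (I.mem_wire_of_ne J ?_).2 ⟨by norm_num, le_rfl, ?_, rfl⟩
        · rintro ⟨h1, h2⟩
          -- The label of the closing arc is fixed by `matching`, so by injectivity no other strand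
          -- end is assigned to it.
          have h3 : I.matching (k, b) = I.matching ((I.matching (k, b)).1, false) := by
            rw [I.matching_zero h1]
            exact Prod.ext rfl h2
          have h4 := I.matching.injective h3
          rw [Prod.mk.injEq] at h4
          exact h ⟨by rw [h4.1]; exact h1, h4.2⟩
        · rw [I.pointX_matching]
          ring

theorem shiftTangle_union_closingArc :
    shiftTangle I J ∪ closingArc = ⋃ q, I.wire J q := by
  apply Subset.antisymm
  · refine union_subset (union_subset ?_ ?_) ?_
    · refine iUnion_subset fun i => Subset.trans ?_ (subset_iUnion _ (i, true))
      unfold wire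
      rw [if_neg (by simp)]
      exact Subset.rfl
    · refine iUnion₂_subset fun i hi => ?_
      have hi0 : (i.castPred hi.2).val ≠ 0 := fun h => hi.1 (Fin.ext h)
      refine Subset.trans ?_ (subset_iUnion _ (i.castPred hi.2, false))
      unfold wire
      rw [if_neg (fun h => hi0 h.1)]
      exact Subset.rfl
    · rw [← I.wire_zero J (k := ⟨0, I.pos⟩) rfl]
      exact subset_iUnion _ _
  · refine iUnion_subset fun q => ?_
    by_cases hq : q.1.val = 0 ∧ q.2 = false
    · unfold wire
      rw [if_pos hq]
      exact subset_union_right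
    · unfold wire
      rw [if_neg hq]
      refine Subset.trans ?_ subset_union_left
      obtain ⟨k, _ | _⟩ := q
      · refine Subset.trans ?_ subset_union_right
        have hk : k.val ≠ 0 := fun h => hq ⟨h, rfl⟩
        refine subset_iUnion₂ (s := fun (i : Fin (n + 1)) (_ : i ≠ 0 ∧ i ≠ Fin.last n) =>
          segment ℝ (I.a i, (0 : ℝ), (0 : ℝ)) (J.a i, -1, 0)) k.castSucc
          ⟨fun h => hk ?_, (Fin.castSucc_lt_last k).ne⟩
        have := congrArg Fin.val h
        simpa using this
      · refine Subset.trans ?_ subset_union_left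
        exact subset_iUnion (fun i : Fin n => segment ℝ
          (intervalMid (I.a i.castSucc, I.a i.succ), (0 : ℝ), (0 : ℝ))
          (intervalMid (J.a i.castSucc, J.a i.succ), -1, 0)) k

/-! ### The components of the link -/

/-- The pieces of the link of a pair of partitions: the strands of the upper tangle, those of the
lower tangle, and the wires. -/
noncomputable def piece : (Fin n ⊕ Fin n) ⊕ Fin n × Bool → Set (ℝ × ℝ × ℝ) :=
  Sum.elim (Sum.elim I.strand fun k => vmirror '' J.strand k) (I.wire J)

theorem pairLink_eq_iUnion_piece : pairLink I J = ⋃ i, I.piece J i := by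
  rw [iUnion_sum, iUnion_sum]
  change _ = ((⋃ k, I.strand k) ∪ ⋃ k, vmirror '' J.strand k) ∪ ⋃ q, I.wire J q
  rw [← image_iUnion, ← tangle_eq_iUnion_strand, ← tangle_eq_iUnion_strand,
    ← shiftTangle_union_closingArc]
  unfold pairLink
  ac_rfl

theorem isClosed_piece (i) : IsClosed (I.piece J i) := by
  rcases i with (k | k) | q
  · exact I.isClosed_strand k
  · change IsClosed (vmirror '' J.strand k)
    rw [image_vmirror]
    exact (J.isClosed_strand k).preimage continuous_vmirror
  · exact I.isClosed_wire J q

theorem isConnected_piece (i) : IsConnected (I.piece J i) := by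
  rcases i with (k | k) | q
  · exact I.isConnected_strand k
  · exact (J.isConnected_strand k).image _ continuous_vmirror.continuousOn
  · exact I.isConnected_wire J q

theorem strand_inter_mirror {k l : Fin n} : ¬ (I.strand k ∩ vmirror '' J.strand l).Nonempty := by
  rintro ⟨_, hk, p, hl, rfl⟩
  have h1 := (I.bounds_of_mem_strand hk).2.1
  have h2 := (J.bounds_of_mem_strand hl).2.1
  simp only [vmirror] at h1
  linarith

theorem mirror_inter_mirror {k l : Fin n}
    (h : (vmirror '' J.strand k ∩ vmirror '' J.strand l).Nonempty) : k = l := by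
  obtain ⟨p, hk, hl⟩ := h
  rw [image_vmirror] at hk hl
  exact J.strand_inter ⟨vmirror p, hk, hl⟩

theorem mirror_inter_wire {k : Fin n} {q : Fin n × Bool} :
    (vmirror '' J.strand k ∩ I.wire J q).Nonempty ↔ ∃ b, q = J.matching (k, b) := by
  rw [← J.strand_inter_wire I]
  constructor
  · rintro ⟨_, ⟨p, hk, rfl⟩, hq⟩
    exact ⟨p, hk, (J.vmirror_mem_wire I).1 hq⟩
  · rintro ⟨p, hk, hq⟩
    exact ⟨vmirror p, ⟨p, hk, rfl⟩, (J.vmirror_mem_wire I).2 hq⟩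

/-- The classes of the pieces of the link that are generated by intersecting each other correspond
to the cycles of the two matchings. -/
theorem nonempty_quot_piece_equiv :
    Nonempty (Quot (fun i j => (I.piece J i ∩ I.piece J j).Nonempty) ≃
      Quot (MatchRel I.matching J.matching)) := by
  set R := MatchRel I.matching J.matching with hR
  have hI : ∀ k b, Quot.mk R (I.matching (k, b)) = Quot.mk R (I.matching (k, false)) := by
    rintro k (_ | _)
    · rfl
    · exact (Quot.sound ⟨k, Or.inl ⟨rfl, rfl⟩⟩).symm
  have hJ : ∀ k b, Quot.mk R (J.matching (k, b)) = Quot.mk R (J.matching (k, false)) := by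
    rintro k (_ | _)
    · rfl
    · exact (Quot.sound ⟨k, Or.inr ⟨rfl, rfl⟩⟩).symm
  set r : (Fin n ⊕ Fin n) ⊕ Fin n × Bool → (Fin n ⊕ Fin n) ⊕ Fin n × Bool → Prop :=
    fun i j => (I.piece J i ∩ I.piece J j).Nonempty with hr
  have hI' : ∀ k b, Quot.mk r (Sum.inl (Sum.inl k)) = Quot.mk r (Sum.inr (I.matching (k, b))) :=
    fun k b => Quot.sound ((I.strand_inter_wire J).2 ⟨b, rfl⟩)
  have hJ' : ∀ k b, Quot.mk r (Sum.inl (Sum.inr k)) = Quot.mk r (Sum.inr (J.matching (k, b))) :=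
    fun k b => Quot.sound ((I.mirror_inter_wire J).2 ⟨b, rfl⟩)
  -- Every strand meets a wire, so wires represent all classes; a strand is sent to the class of the
  -- wire at its left end.
  refine ⟨⟨Quot.lift (Sum.elim (Sum.elim (fun k => Quot.mk R (I.matching (k, false)))
      fun k => Quot.mk R (J.matching (k, false))) (Quot.mk R)) ?_,
    Quot.lift (fun q => Quot.mk r (Sum.inr q)) ?_, ?_, ?_⟩⟩
  · rintro ((k | k) | q) ((l | l) | s) h
    · rw [I.strand_inter h]
    · exact absurd h (I.strand_inter_mirror J)
    · obtain ⟨b, rfl⟩ := (I.strand_inter_wire J).1 h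
      exact (hI k b).symm
    · rw [hr, inter_comm] at h
      exact absurd h (I.strand_inter_mirror J)
    · rw [J.mirror_inter_mirror h]
    · obtain ⟨b, rfl⟩ := (I.mirror_inter_wire J).1 h
      exact (hJ k b).symm
    · rw [hr, inter_comm] at h
      obtain ⟨b, rfl⟩ := (I.strand_inter_wire J).1 h
      exact hI l b
    · rw [hr, inter_comm] at h
      obtain ⟨b, rfl⟩ := (I.mirror_inter_wire J).1 h
      exact hJ l b
    · rw [I.wire_inter J h]
  · rintro _ _ ⟨k, ⟨rfl, rfl⟩ | ⟨rfl, rfl⟩⟩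
    · exact (hI' k false).symm.trans (hI' k true)
    · exact (hJ' k false).symm.trans (hJ' k true)
  · intro x
    induction x using Quot.ind with
    | mk x =>
      rcases x with (k | k) | q
      · exact (hI' k false).symm
      · exact (hJ' k false).symm
      · rfl
  · intro x
    induction x using Quot.ind with
    | mk x => rfl

end SDPartition

/-- The components of the link of a pair of partitions correspond to the cycles of the two
matchings. -/
theorem nonempty_connectedComponents_pairLink_equiv {n : ℕ} (I J : SDPartition n) :
    Nonempty (ConnectedComponents (pairLink I J) ≃ Quot (MatchRel I.matching J.matching)) := by
  rw [I.pairLink_eq_iUnion_piece J]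
  obtain ⟨e⟩ := nonempty_connectedComponents_iUnion_equiv (I.piece J) (I.isClosed_piece J)
    (I.isConnected_piece J)
  obtain ⟨e'⟩ := I.nonempty_quot_piece_equiv J
  exact ⟨e.trans e'⟩

/-! ### Signs of the reduced pair -/

/-- A region signing restricts to a coarser partition. -/
theorem IsRegionSigning.comp {n k : ℕ} {I : SDPartition n} {K : SDPartition k} {σ : Fin n → ℤˣ}
    (h : IsRegionSigning I σ) (f : Fin k → Fin n)
    (hf : ∀ i, I.a (f i).castSucc = K.a i.castSucc) (hKI : range K.a ⊆ range I.a) :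
    IsRegionSigning K (σ ∘ f) := by
  refine ⟨fun i hi => h.1 _ ((hf i).trans hi), fun i m j hij hm => ?_⟩
  obtain ⟨l, hl⟩ := hKI ⟨j, rfl⟩
  refine h.2 (f i) (f m) l ?_ ?_
  · rw [hf, hl]; exact hij
  · rw [hf, hf, hl]; exact hm

/-- By reducedness, the common coarsening of the two pairs is `(K, L)` itself. Hence `(I, J)`
refines `(K, L)` and its signing can be restricted. -/
theorem IsReducedPair.exists_signing {n m : ℕ} {I J : SDPartition n} {K L : SDPartition m}
    {g : unitInterval ≃ₜ unitInterval} (h : IsReducedPair K L g) (h' : Represents I J g)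
    {σ : Fin n → ℤˣ} (hI : IsRegionSigning I σ) (hJ : IsRegionSigning J σ) :
    ∃ τ : Fin m → ℤˣ, IsRegionSigning K τ ∧ IsRegionSigning L τ := by
  obtain ⟨k, K', L', hKL, h1, h2, h3, h4⟩ := h.1.exists_common h'
  obtain ⟨e1, e2⟩ := h.2 k K' L' hKL h1 h2
  rw [e1] at h3
  rw [e2] at h4
  have hex : ∀ i : Fin m, ∃ j : Fin n, I.a j.castSucc = K.a i.castSucc := fun i =>
    I.exists_left (h3 ⟨_, rfl⟩) (K.castSucc_lt_one i)
  choose f hf using hex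
  refine ⟨σ ∘ f, hI.comp f hf h3, hJ.comp f (fun i => ?_) h4⟩
  -- The same index map `f` works for the second partitions, because `g` carries breakpoints to
  -- breakpoints of the same index in both pairs.
  rw [← h'.apply, ← h.1.apply]
  congr 2
  exact Subtype.ext (hf i)

theorem mainTheorem4 (g : orientedThompsonGroup) (n : ℕ) (hn : leafNumber g = n) :
    Finite (ConnectedComponents (thompsonLink g)) ∧
      Nat.card (ConnectedComponents (thompsonLink g)) ≡ n [MOD 2] := by
  subst hn
  have hred : IsReducedPair (reducedPair g).2.1 (reducedPair g).2.2 (g : _ ≃ₜ _) :=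
    (existsUnique_reducedPair g).choose_spec.1
  obtain ⟨-, m, I, J, hIJ, σ, hI, hJ⟩ := g.2
  obtain ⟨τ, hτ, hτ'⟩ := hred.exists_signing hIJ hI hJ
  obtain ⟨e⟩ := nonempty_connectedComponents_pairLink_equiv (reducedPair g).2.1 (reducedPair g).2.2
  refine ⟨Finite.of_equiv _ e.symm, ?_⟩
  have := card_quot_matchRel_matching hτ hτ'
  rw [← Nat.card_congr e] at this
  exact this
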